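/- **Setting (power network).** A network has $n\ge 1$ generators, their $n$ terminal buses and $m\ge 0$ load buses, forming the $2n+m$ vertices of a connected weighted graph (positive weights on the lines between buses and on the edge joining each generator to its own terminal bus). Let $\begin{bmatrix}\mathcal L_{gg}&\mathcal L_{gl}\\ \mathcal L_{lg}&\mathcal L_{ll}\end{bmatrix}$ be its Laplacian (generators first, then the $n+m$ buses), $M\succ 0$ and $D_g$ the diagonal matrices of inertias and damping constants, $C\in\mathbb R^{p\times(3n+m)}$ arbitrary. With state $x=(\delta,\omega,\theta)\in\mathbb R^{n}\times\mathbb R^n\times\mathbb R^{n+m}$ consider $$E\dot x=Ax+Bu,\quad y=Cx+Du,\quad E=\operatorname{diag}(I,M,0),\quad A=-\begin{bmatrix}0&-I&0\\ \mathcal L_{gg}&D_g&\mathcal L_{gl}\\ \mathcal L_{lg}&0&\mathcal L_{ll}\end{bmatrix},\quad B=[\,I\;\;0\,],\quad D=[\,0\;\;I\,].$$ An attack set is a set $K\subseteq\{1,\dots,3n+m+p\}$; an attack mode of $K$ is a piecewise continuous $u:[0,\infty)\to\mathbb R^{3n+m+p}$ whose entries vanish outside $K$ and are nonzero signals (not almost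 everywhere zero) for each index in $K$. Along a trajectory, $Ex$ is continuous, the differential equations hold at the continuity points of $u$, and the algebraic equations hold at all $t\ge0$. $K$ is *unidentifiable* if there are an attack set $R\ne K$ with $|R|\le|K|$, attack modes $u_K,u_R$ and initial states for which the outputs coincide for all $t\ge 0$; otherwise $K$ is *identifiable*. Eliminating $\theta=-\mathcal L_{ll}^{-1}\mathcal L_{lg}\delta+\mathcal L_{ll}^{-1}f_\theta$, where $f_\theta$ denotes the entries of $u$ acting on the bus equations, gives the Kron-reduced system with state $(\delta,\omega)\in\mathbb R^{2n}$ and matrices $\tilde A,\tilde B,\tilde C,\tilde D$: $$\tilde A=\begin{bmatrix}0&I\\-M^{-1}(\mathcal L_{gg}-\mathcal L_{gl}\mathcal L_{ll}^{-1}\mathcal L_{lg})&-M^{-1}D_g\end{bmatrix},\quad \tilde B=\begin{bmatrix}F_\delta&0\\ M^{-1}F_\omega-M^{-1}\mathcal L_{gl}\mathcal L_{ll}^{-1}F_\theta&0\end{bmatrix},$$ $$\tilde C=[\,C_\delta-C_\theta\mathcal L_{ll}^{-1}\mathcal L_{lg}\;\;\;C_\omega\,],\quad \tilde D=[\,C_\theta\mathcal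 L_{ll}^{-1}F_\theta\;\;\;I\,],$$ where $F_\delta,F_\omega,F_\theta$ are the row blocks of the identity and $C=[C_\delta\;C_\omega\;C_\theta]$. **Filter for a candidate set $K$.** Let $\tilde B_K,\tilde D_K$ be the columns of $\tilde B,\tilde D$ indexed by $K$. Let $\begin{bmatrix}V_K\\Q_K\end{bmatrix}\in\mathbb R^{p\times p}$ be orthogonal, the rows of $V_K$ (of $Q_K$) forming a basis of $\operatorname{Im}\tilde D_K$ (of $(\operatorname{Im}\tilde D_K)^\perp$). With ${}^\dagger$ the Moore–Penrose inverse put $$B_Z=\tilde B_K(V_K\tilde D_K)^\dagger,\qquad \bar B_K=\tilde B_K(I-\tilde D_K^\dagger\tilde D_K),\qquad A'=\tilde A-B_ZV_K\tilde C.$$ Let $\mathcal S^*$ be the smallest subspace $S\supseteq\operatorname{Im}\bar B_K$ with $A'(S\cap\operatorname{Ker}(Q_K\tilde C))\subseteq S$, let $J_K$ satisfy $(A'+J_KQ_K\tilde C)\mathcal S^*\subseteq\mathcal S^*$, let $P_K$ satisfy $P_KP_K^{\mathsf T}=I$ and $\operatorname{Ker}P_K=\mathcal S^*$, and let $A_K=P_K(A'+J_KQ_K\tilde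 C)P_K^{\mathsf T}$. Let $H_K,M_K$ satisfy $$\operatorname{Ker}(H_KQ_K\tilde C)=\mathcal S^*+\operatorname{Ker}(Q_K\tilde C),\qquad \operatorname{Ker}H_K\subseteq\operatorname{Im}(Q_K\tilde C),\qquad H_KQ_K\tilde C=M_KP_K$$ (the inclusion is automatic if $\tilde C$ has full row rank), and let $G_K$ be such that $A_K+G_KM_K$ is Hurwitz. **Theorem.** Let $K^*$ be the true attack set, assumed identifiable, acting through any attack mode $u$ of $K^*$, let $x$ be a corresponding trajectory with known initial state and $y=Cx+Du$ its output. Let $K$ be a candidate set with $|K|\le|K^*|$, with any filter data as above, and consider $$\dot w_K=(A_K+G_KM_K)w_K+\bigl(P_KB_ZV_K-(P_KJ_K+G_KH_K)Q_K\bigr)y,\quad w_K(0)=P_K\begin{bmatrix}\delta(0)\\ \omega(0)\end{bmatrix},\quad r_K=M_Kw_K-H_KQ_Ky.$$ Then $r_K(t)=0$ for all $t\ge0$ if and only if $K=K^*$. -/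

import Mathlib

open Matrix Filter Topology

/-! ### Linear algebra -/

/-- The four Penrose equations: `X` is the Moore-Penrose inverse of the real matrix `A`. -/
structure IsMoorePenrose {m n : Type*} [Fintype m] [Fintype n]
    (A : Matrix m n ℝ) (X : Matrix n m ℝ) : Prop where
  mul_mul_left : A * X * A = A
  mul_mul_right : X * A * X = X
  symm_left : (A * X)ᵀ = A * X
  symm_right : (X * A)ᵀ = X * A

theorem exists_isMoorePenrose {m n : Type*} [Fintype m] [Fintype n]
    (A : Matrix m n ℝ) : ∃ X : Matrix n m ℝ, IsMoorePenrose A X := by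
  classical
  have hG : (Aᵀ * A).IsHermitian := by
    have h := Matrix.isHermitian_conjTranspose_mul_self A
    rwa [Matrix.conjTranspose_eq_transpose_of_trivial] at h
  obtain ⟨U, d, hU, hspec⟩ : ∃ (U : Matrix n n ℝ) (d : n → ℝ),
      Uᵀ * U = 1 ∧ Aᵀ * A = U * diagonal d * Uᵀ := by
    refine ⟨hG.eigenvectorUnitary, hG.eigenvalues, ?_, ?_⟩
    · have h := (Matrix.mem_unitaryGroup_iff'.mp hG.eigenvectorUnitary.2)
      rwa [Matrix.star_eq_conjTranspose, Matrix.conjTranspose_eq_transpose_of_trivial] at h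
    · have h := hG.spectral_theorem
      rw [Unitary.conjStarAlgAut_apply, Matrix.star_eq_conjTranspose,
        Matrix.conjTranspose_eq_transpose_of_trivial] at h
      exact h
  set S : Matrix n n ℝ := U * diagonal (fun i => (d i)⁻¹) * Uᵀ with hS
  have mulU : ∀ a b : n → ℝ, (U * diagonal a * Uᵀ) * (U * diagonal b * Uᵀ)
      = U * diagonal (fun i => a i * b i) * Uᵀ := by
    intro a b
    calc (U * diagonal a * Uᵀ) * (U * diagonal b * Uᵀ)
        = U * diagonal a * (Uᵀ * U) * diagonal b * Uᵀ := by simp only [Matrix.mul_assoc]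
      _ = U * (diagonal a * diagonal b) * Uᵀ := by
          rw [hU, Matrix.mul_one, Matrix.mul_assoc U]
      _ = _ := by rw [diagonal_mul_diagonal]
  have trU : ∀ a : n → ℝ, (U * diagonal a * Uᵀ)ᵀ = U * diagonal a * Uᵀ := by
    intro a
    simp [Matrix.transpose_mul, Matrix.mul_assoc]
  have hSt : Sᵀ = S := trU _
  have hSGS : S * (Aᵀ * A) * S = S := by
    rw [hspec, hS, mulU, mulU]
    congr 3
    funext i
    by_cases h : d i = 0 <;> simp [h]
  have hGSG : Aᵀ * A * S * (Aᵀ * A) = Aᵀ * A := by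
    rw [hspec, hS, mulU, mulU]
    congr 3
    funext i
    by_cases h : d i = 0 <;> simp [h]
  have hSGt : (S * (Aᵀ * A))ᵀ = S * (Aᵀ * A) := by
    rw [hspec, hS, mulU]
    exact trU _
  have key : A * (S * (Aᵀ * A)) - A = 0 := by
    have h0 : Aᵀ * (A * (S * (Aᵀ * A)) - A) = 0 := by
      rw [Matrix.mul_sub, sub_eq_zero]
      simpa only [Matrix.mul_assoc] using hGSG
    have h1 : (A * (S * (Aᵀ * A)) - A)ᵀ * (A * (S * (Aᵀ * A)) - A) = 0 := by
      have : (A * (S * (Aᵀ * A)) - A)ᵀ = (S * (Aᵀ * A) - 1)ᵀ * Aᵀ := by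
        rw [← Matrix.transpose_mul, Matrix.mul_sub, Matrix.mul_one]
      rw [this, Matrix.mul_assoc, h0, Matrix.mul_zero]
    rw [← Matrix.conjTranspose_eq_transpose_of_trivial] at h1
    exact Matrix.conjTranspose_mul_self_eq_zero.mp h1
  refine ⟨S * Aᵀ, ⟨?_, ?_, ?_, ?_⟩⟩
  · rw [sub_eq_zero] at key
    simpa only [Matrix.mul_assoc] using key
  · calc S * Aᵀ * A * (S * Aᵀ) = (S * (Aᵀ * A) * S) * Aᵀ := by simp only [Matrix.mul_assoc]
      _ = S * Aᵀ := by rw [hSGS]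
  · simp [Matrix.transpose_mul, hSt, Matrix.mul_assoc]
  · simpa only [Matrix.mul_assoc] using hSGt

/-- The Moore-Penrose inverse of a real matrix. -/
noncomputable def pinv {m n : Type*} [Fintype m] [Fintype n] (A : Matrix m n ℝ) :
    Matrix n m ℝ :=
  (exists_isMoorePenrose A).choose

theorem pinv_spec {m n : Type*} [Fintype m] [Fintype n] (A : Matrix m n ℝ) :
    IsMoorePenrose A (pinv A) :=
  (exists_isMoorePenrose A).choose_spec

/-- A real square matrix is Hurwitz if all its complex eigenvalues have negative real part. -/
def IsHurwitz {n : Type*} [Fintype n] [DecidableEq n] (A : Matrix n n ℝ) : Prop :=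
  ∀ z ∈ spectrum ℂ (A.map (algebraMap ℝ ℂ)), z.re < 0

/-- `S` is an `(A, N)`-conditioned invariant subspace: `A (S ∩ N) ⊆ S`. -/
def IsConditionedInvariant {X : Type*} [Fintype X] (A : Matrix X X ℝ)
    (N S : Submodule ℝ (X → ℝ)) : Prop :=
  (S ⊓ N).map A.mulVecLin ≤ S

/-- The smallest `(A, N)`-conditioned invariant subspace containing `W`. -/
def smallestConditionedInvariant {X : Type*} [Fintype X] (A : Matrix X X ℝ)
    (N W : Submodule ℝ (X → ℝ)) : Submodule ℝ (X → ℝ) :=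
  sInf {S | IsConditionedInvariant A N S ∧ W ≤ S}

theorem smallestConditionedInvariant_isLeast {X : Type*} [Fintype X] (A : Matrix X X ℝ)
    (N W : Submodule ℝ (X → ℝ)) :
    IsLeast {S | IsConditionedInvariant A N S ∧ W ≤ S} (smallestConditionedInvariant A N W) := by
  refine ⟨⟨?_, le_sInf fun S hS => hS.2⟩, fun S hS => sInf_le hS⟩
  refine le_sInf fun S hS => le_trans (Submodule.map_mono ?_) hS.1
  exact inf_le_inf_right N (sInf_le hS)

/-! ### The power network -/

/-- The `n` generator terminal buses followed by the `m` load buses. -/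
abbrev Bus (n m : ℕ) : Type := Fin n ⊕ Fin m

/-- Vertices of the network graph: the `n` generators followed by the buses. -/
abbrev Vertex (n m : ℕ) : Type := Fin n ⊕ Bus n m

/-- Indices of the state `(δ, ω, θ)`. -/
abbrev StateIdx (n m : ℕ) : Type := (Fin n ⊕ Fin n) ⊕ Bus n m

/-- Indices of the attack modes: one per state variable, one per measurement. -/
abbrev AttackIdx (n m p : ℕ) : Type := StateIdx n m ⊕ Fin p

/-- The weighted adjacency matrix of the network: generator `i` is joined to its own terminal bus
with weight `g i`, and the buses are joined by the lines with weights `Y`. -/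
def networkWeight {n m : ℕ} (g : Fin n → ℝ) (Y : Matrix (Bus n m) (Bus n m) ℝ) :
    Matrix (Vertex n m) (Vertex n m) ℝ :=
  fromBlocks 0 (fromCols (diagonal g) 0) (fromRows (diagonal g) 0) Y

/-- A connected power network with `n` generators and `m` load buses. -/
structure PowerNetwork (n m : ℕ) where
  /-- admittance weight of the internal connection between a generator and its terminal bus -/
  internalWeight : Fin n → ℝ
  internalWeight_pos : ∀ i, 0 < internalWeight i
  /-- susceptances of the transmission lines, `0` where there is no line -/
  lineWeight : Matrix (Bus n m) (Bus n m) ℝ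
  lineWeight_symm : lineWeight.IsSymm
  lineWeight_nonneg : ∀ i j, 0 ≤ lineWeight i j
  lineWeight_diag : ∀ i, lineWeight i i = 0
  connected : (SimpleGraph.fromRel fun v w : Vertex n m =>
    networkWeight internalWeight lineWeight v w ≠ 0).Connected
  /-- inertias of the generators -/
  inertia : Fin n → ℝ
  inertia_pos : ∀ i, 0 < inertia i
  /-- damping constants of the generators -/
  damping : Fin n → ℝ

namespace PowerNetwork

variable {n m p : ℕ} (N : PowerNetwork n m)

/-- The weighted graph Laplacian of the network. -/
def laplacian : Matrix (Vertex n m) (Vertex n m) ℝ :=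
  diagonal (fun v => ∑ w, networkWeight N.internalWeight N.lineWeight v w)
    - networkWeight N.internalWeight N.lineWeight

def Lgg : Matrix (Fin n) (Fin n) ℝ := N.laplacian.toBlocks₁₁
def Lgl : Matrix (Fin n) (Bus n m) ℝ := N.laplacian.toBlocks₁₂
def Llg : Matrix (Bus n m) (Fin n) ℝ := N.laplacian.toBlocks₂₁
def Lll : Matrix (Bus n m) (Bus n m) ℝ := N.laplacian.toBlocks₂₂

/-- The descriptor matrix `diag(I, M, 0)`. -/
def E : Matrix (StateIdx n m) (StateIdx n m) ℝ :=
  fromBlocks (fromBlocks 1 0 0 (diagonal N.inertia)) 0 0 0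

/-- The descriptor system matrix. -/
def A : Matrix (StateIdx n m) (StateIdx n m) ℝ :=
  -fromBlocks (fromBlocks 0 (-1) N.Lgg (diagonal N.damping)) (fromRows 0 N.Lgl)
    (fromCols N.Llg 0) N.Lll

end PowerNetwork

/-- The attack input matrix `B = [I 0]`. -/
def attackB (n m p : ℕ) : Matrix (StateIdx n m) (AttackIdx n m p) ℝ := fromCols 1 0

/-- The attack feedthrough matrix `D = [0 I]`. -/
def attackD (n m p : ℕ) : Matrix (Fin p) (AttackIdx n m p) ℝ := fromCols 0 1

/-! ### Kron reduction -/

namespace PowerNetwork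

variable {n m p : ℕ} (N : PowerNetwork n m)

noncomputable def kronA : Matrix (Fin n ⊕ Fin n) (Fin n ⊕ Fin n) ℝ :=
  fromBlocks 0 1
    (-((diagonal N.inertia)⁻¹ * (N.Lgg - N.Lgl * N.Lll⁻¹ * N.Llg)))
    (-((diagonal N.inertia)⁻¹ * diagonal N.damping))

/-- `[F_δ, 0; M⁻¹ F_ω - M⁻¹ L_gl L_ll⁻¹ F_θ, 0]` with `F = I`. -/
noncomputable def kronB (p : ℕ) : Matrix (Fin n ⊕ Fin n) (AttackIdx n m p) ℝ :=
  let F : Matrix (StateIdx n m) (StateIdx n m) ℝ := 1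
  fromRows
    (fromCols F.toRows₁.toRows₁ 0)
    (fromCols ((diagonal N.inertia)⁻¹ * F.toRows₁.toRows₂
      - (diagonal N.inertia)⁻¹ * N.Lgl * N.Lll⁻¹ * F.toRows₂) 0)

/-- `[C_δ - C_θ L_ll⁻¹ L_lg, C_ω]`. -/
noncomputable def kronC (C : Matrix (Fin p) (StateIdx n m) ℝ) :
    Matrix (Fin p) (Fin n ⊕ Fin n) ℝ :=
  fromCols (C.toCols₁.toCols₁ - C.toCols₂ * N.Lll⁻¹ * N.Llg) C.toCols₁.toCols₂

/-- `[C_θ L_ll⁻¹ F_θ, L]` with `F = I`, `L = I`; eliminating the bus angles from the algebraic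
equation gives `θ = -L_ll⁻¹ L_lg δ + L_ll⁻¹ F_θ f`. -/
noncomputable def kronD (C : Matrix (Fin p) (StateIdx n m) ℝ) :
    Matrix (Fin p) (AttackIdx n m p) ℝ :=
  let F : Matrix (StateIdx n m) (StateIdx n m) ℝ := 1
  fromCols (C.toCols₂ * N.Lll⁻¹ * F.toRows₂) 1

end PowerNetwork

/-! ### Trajectories, attack modes, identifiability -/

/-- Piecewise continuity of a signal on `[0, ∞)`: finitely many discontinuities on bounded
intervals, and one-sided limits everywhere. -/
def IsPiecewiseContinuous {V : Type*} [TopologicalSpace V] (f : ℝ → V) : Prop :=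
  (∀ T : ℝ, {t | t ∈ Set.Ioo 0 T ∧ ¬ ContinuousAt f t}.Finite) ∧
  (∀ t > 0, ∃ l, Tendsto f (𝓝[<] t) (𝓝 l)) ∧
  (∀ t ≥ 0, ∃ l, Tendsto f (𝓝[>] t) (𝓝 l))

/-- `u` is an attack mode of the attack set `K`: it is piecewise continuous, the entries outside `K`
vanish, and every entry indexed by `K` is a nonzero signal (signals that differ only on a null set
being identified). -/
def IsAttackMode {ι : Type*} (K : Finset ι) (u : ℝ → ι → ℝ) : Prop :=
  IsPiecewiseContinuous u ∧
  (∀ i ∉ K, ∀ t ≥ 0, u t i = 0) ∧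
  (∀ i ∈ K, ¬ ∀ᵐ t ∂(MeasureTheory.volume.restrict (Set.Ici (0 : ℝ))), u t i = 0)

namespace PowerNetwork

variable {n m p : ℕ} (N : PowerNetwork n m)

/-- `x` is a state trajectory on `[0, ∞)` of the descriptor system `E ẋ = A x + B u`: `E x` is
continuous, the differential equation holds at the continuity points of `u`, and the algebraic (bus)
equations hold at all times, the initial one included. -/
def IsTrajectory (u : ℝ → AttackIdx n m p → ℝ) (x : ℝ → StateIdx n m → ℝ) : Prop :=
  ContinuousOn (fun t => N.E *ᵥ x t) (Set.Ici 0) ∧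
  (∀ t > 0, ContinuousAt u t →
    HasDerivAt (fun s => N.E *ᵥ x s) (N.A *ᵥ x t + attackB n m p *ᵥ u t) t) ∧
  (∀ t ≥ 0, ∀ b : Bus n m, (N.A *ᵥ x t + attackB n m p *ᵥ u t) (Sum.inr b) = 0)

/-- The attack set `K` is unidentifiable, the measurements being checked at all times `t ≥ 0`:
some attack set `R ≠ K` with `|R| ≤ |K|` can produce the same measurements. -/
def IsUnidentifiable (C : Matrix (Fin p) (StateIdx n m) ℝ) (K : Finset (AttackIdx n m p)) : Prop :=
  ∃ R : Finset (AttackIdx n m p), R.card ≤ K.card ∧ R ≠ K ∧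
    ∃ (uK uR : ℝ → AttackIdx n m p → ℝ) (xK xR : ℝ → StateIdx n m → ℝ),
      IsAttackMode K uK ∧ IsAttackMode R uR ∧ N.IsTrajectory uK xK ∧ N.IsTrajectory uR xR ∧
      ∀ t ≥ 0, C *ᵥ xK t + attackD n m p *ᵥ uK t = C *ᵥ xR t + attackD n m p *ᵥ uR t

def IsIdentifiable (C : Matrix (Fin p) (StateIdx n m) ℝ) (K : Finset (AttackIdx n m p)) : Prop :=
  ¬ N.IsUnidentifiable C K

end PowerNetwork

/-! ### The identification filter -/

/-- The submatrix of the columns indexed by `K`. -/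
def colsOf {r ι : Type*} (B : Matrix r ι ℝ) (K : Finset ι) : Matrix r {i // i ∈ K} ℝ :=
  B.submatrix id Subtype.val

/-- The design parameters of the identification filter of a system `ẋ = A x + B u`, `y = C x + D u`
with unknown input `u` (the matrices `B` and `D` are already restricted to the candidate set). -/
structure IdentificationFilter {X U : Type*} [Fintype X] [DecidableEq X] [Fintype U] [DecidableEq U]
    {p : ℕ} (A : Matrix X X ℝ) (B : Matrix X U ℝ) (C : Matrix (Fin p) X ℝ)
    (D : Matrix (Fin p) U ℝ) where
  /-- the numbers of rows of `V`, `Q`, `P`, `H` -/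
  (v q s h : ℕ)
  V : Matrix (Fin v) (Fin p) ℝ
  Q : Matrix (Fin q) (Fin p) ℝ
  orthonormal_VQ : fromRows V Q * (fromRows V Q)ᵀ = 1
  span_V : Submodule.span ℝ (Set.range V.row) = LinearMap.range D.mulVecLin
  /-- the rows of `Q` span `Im(D)ᗮ` -/
  span_Q : ∀ z : Fin p → ℝ,
    z ∈ Submodule.span ℝ (Set.range Q.row) ↔ ∀ y ∈ LinearMap.range D.mulVecLin, z ⬝ᵥ y = 0
  /-- the subspace `S*` -/
  S : Submodule ℝ (X → ℝ)
  S_eq : S = smallestConditionedInvariant (A - B * pinv (V * D) * V * C)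
    (LinearMap.ker (Q * C).mulVecLin)
    (LinearMap.range (B * (1 - pinv D * D)).mulVecLin)
  /-- the output injection matrix -/
  J : Matrix X (Fin q) ℝ
  J_spec : S.map (A - B * pinv (V * D) * V * C + J * Q * C).mulVecLin ≤ S
  /-- the orthonormal projection onto the quotient space by `S*` -/
  P : Matrix (Fin s) X ℝ
  orthonormal_P : P * Pᵀ = 1
  ker_P : LinearMap.ker P.mulVecLin = S
  H : Matrix (Fin h) (Fin q) ℝ
  M : Matrix (Fin h) (Fin s) ℝ
  ker_HQC : LinearMap.ker (H * Q * C).mulVecLin = S ⊔ LinearMap.ker (Q * C).mulVecLin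
  /-- `H` discards no measurement combination outside `Im(Q C)`; automatic if `C` has full row
  rank -/
  ker_H : LinearMap.ker H.mulVecLin ≤ LinearMap.range (Q * C).mulVecLin
  M_spec : H * Q * C = M * P
  G : Matrix (Fin s) (Fin h) ℝ
  hurwitz : IsHurwitz (P * (A - B * pinv (V * D) * V * C + J * Q * C) * Pᵀ + G * M)

namespace IdentificationFilter

variable {X U : Type*} [Fintype X] [DecidableEq X] [Fintype U] [DecidableEq U] {p : ℕ}
  {A : Matrix X X ℝ} {B : Matrix X U ℝ} {C : Matrix (Fin p) X ℝ} {D : Matrix (Fin p) U ℝ}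
  (Φ : IdentificationFilter A B C D)

/-- The matrix `A_K` of the filter. -/
noncomputable def AK : Matrix (Fin Φ.s) (Fin Φ.s) ℝ :=
  Φ.P * (A - B * pinv (Φ.V * D) * Φ.V * C + Φ.J * Φ.Q * C) * Φ.Pᵀ

/-- The matrix `B_Z`. -/
noncomputable def BZ : Matrix X (Fin Φ.v) ℝ := B * pinv (Φ.V * D)

/-- `w` is the filter state driven by the measurements `y`, with `w(0) = P x₀`. -/
def IsResponse (x₀ : X → ℝ) (y : ℝ → Fin p → ℝ) (w : ℝ → Fin Φ.s → ℝ) : Prop :=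
  w 0 = Φ.P *ᵥ x₀ ∧ ContinuousOn w (Set.Ici 0) ∧
  ∀ t > 0, ContinuousAt y t →
    HasDerivAt w ((Φ.AK + Φ.G * Φ.M) *ᵥ w t
      + (Φ.P * Φ.BZ * Φ.V - (Φ.P * Φ.J + Φ.G * Φ.H) * Φ.Q) *ᵥ y t) t

/-- The residual `r = M w - H Q y`. -/
def residual (y : ℝ → Fin p → ℝ) (w : ℝ → Fin Φ.s → ℝ) (t : ℝ) : Fin Φ.h → ℝ :=
  Φ.M *ᵥ w t - (Φ.H * Φ.Q) *ᵥ y t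

end IdentificationFilter

/-! If `K` is the true set, the error `P z - w` between the projected Kron state `z` and the filter
state `w` obeys a homogeneous linear equation: the part of the input seen directly is cancelled
through `V y`, and what remains enters through `S*`, which `P` annihilates. The error starts at
zero, so it stays zero, and the residual is `-M (P z - w) = 0` (`residual_eq_zero`).

Conversely, a zero residual for `K ≠ Kstar` would let inputs in `K` reproduce an attack of `Kstar`.
Inverting the system requires differentiating the output, while attacks are only piecewise
continuous. Plant equations, filter equation, zero residual and vanishing entries are all linear
with constant coefficients, so they survive averaging over sliding windows. Repeated averaging gives
solutions of any finite smoothness, and short windows keep the nonzero entries nonzero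
(`exists_contDiffOn_solution`).

For smooth measurements, zero residual allows `w` to be lifted to a state that fits `Q y` and
satisfies the decoupled equation modulo `S*`. Since `S*` is reached by finitely many steps of the
conditioned invariant subspace algorithm, `exists_steering` pushes the defect down, one derivative
per step, into the range of the hidden inputs. This yields an input in `K` with the same output
(`exists_input_of_residual_eq_zero`). Unidentifiability leaves initial states free, so a small time
shift discards the behaviour at `0`. The support of that input is then a set `R ≠ Kstar` with `|R| ≤
|Kstar|`, contradicting identifiability. -/

/-! ### Sliding averages -/

section Averages

variable {W E : Type*} [NormedAddCommGroup W]

theorem intervalIntegrable_of_oneSidedLimits {f : ℝ → W} {s : Set ℝ} (hs : s.Countable)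
    (hcont : ∀ t > 0, t ∉ s → ContinuousAt f t)
    (hl : ∀ t > 0, ∃ l, Tendsto f (𝓝[<] t) (𝓝 l))
    (hr : ∀ t > 0, ∃ l, Tendsto f (𝓝[>] t) (𝓝 l)) {a b : ℝ} (ha : 0 < a) (hb : 0 < b) :
    IntervalIntegrable f MeasureTheory.volume a b := by
  have hmeas : MeasureTheory.AEStronglyMeasurable f
      (MeasureTheory.volume.restrict (Set.Ioi (0 : ℝ))) := by
    have h1 : MeasureTheory.AEStronglyMeasurable f
        (MeasureTheory.volume.restrict (Set.Ioi (0 : ℝ) \ s)) :=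
      ContinuousOn.aestronglyMeasurable
        (fun t ht => (hcont t ht.1 ht.2).continuousWithinAt)
        (measurableSet_Ioi.diff hs.measurableSet)
    rwa [MeasureTheory.Measure.restrict_congr_set
      (MeasureTheory.sdiff_null_ae_eq_self (hs.measure_zero _))] at h1
  have hloc : ∀ t > 0, MeasureTheory.IntegrableAtFilter f (𝓝 t) MeasureTheory.volume := by
    intro t ht
    have hm : StronglyMeasurableAtFilter f (𝓝 t) MeasureTheory.volume :=
      ⟨_, Ioi_mem_nhds ht, hmeas⟩
    obtain ⟨l, hl⟩ := hl t ht
    obtain ⟨r, hr⟩ := hr t ht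
    have hp : MeasureTheory.IntegrableAtFilter f (pure t) MeasureTheory.volume :=
      ⟨{t}, by simp, by simp⟩
    have hfin : MeasureTheory.volume.FiniteAtFilter (𝓝 t) :=
      MeasureTheory.Measure.finiteAt_nhds _ _
    have h1 := hl.integrableAtFilter (hm.filter_mono nhdsWithin_le_nhds)
      (hfin.filter_mono nhdsWithin_le_nhds)
    have h2 := hr.integrableAtFilter (hm.filter_mono nhdsWithin_le_nhds)
      (hfin.filter_mono nhdsWithin_le_nhds)
    have h3 := MeasureTheory.IntegrableAtFilter.sup_iff.mpr
      ⟨hp, MeasureTheory.IntegrableAtFilter.sup_iff.mpr ⟨h1, h2⟩⟩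
    rwa [nhdsLT_sup_nhdsGT, pure_sup_nhdsNE] at h3
  have hli : MeasureTheory.LocallyIntegrableOn f (Set.Ioi (0 : ℝ)) MeasureTheory.volume :=
    fun t ht => (hloc t ht).filter_mono nhdsWithin_le_nhds
  refine MeasureTheory.IntegrableOn.intervalIntegrable
    ((hli.mono_set ?_).integrableOn_isCompact isCompact_uIcc)
  intro t ht
  exact lt_of_lt_of_le (lt_min ha hb) ht.1

theorem intervalIntegrable_of_continuousOn_Ioi {f : ℝ → W} (hf : ContinuousOn f (Set.Ioi 0))
    (a b : ℝ) (ha : 0 < a) (hb : 0 < b) : IntervalIntegrable f MeasureTheory.volume a b :=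
  (hf.mono fun _ hr => lt_of_lt_of_le (lt_min ha hb) hr.1).intervalIntegrable

variable [NormedSpace ℝ W]

/-- The integral of `f` over the sliding window `[t, t + h]`. -/
noncomputable def slidingIntegral (h : ℝ) (f : ℝ → W) (t : ℝ) : W := ∫ r in t..(t + h), f r

/-- Primitives are based at `1` because integrability is assumed only away from `0`. -/
theorem slidingIntegral_eq_sub {f : ℝ → W}
    (hf : ∀ a b : ℝ, 0 < a → 0 < b → IntervalIntegrable f MeasureTheory.volume a b)
    {h t : ℝ} (hh : 0 < h) (ht : 0 < t) :
    slidingIntegral h f t = (∫ r in (1 : ℝ)..(t + h), f r) - ∫ r in (1 : ℝ)..t, f r :=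
  (intervalIntegral.integral_interval_sub_left (hf _ _ one_pos (by positivity))
    (hf _ _ one_pos ht)).symm

theorem continuousOn_primitive_Ioi {f : ℝ → W}
    (hf : ∀ a b : ℝ, 0 < a → 0 < b → IntervalIntegrable f MeasureTheory.volume a b) :
    ContinuousOn (fun t => ∫ r in (1 : ℝ)..t, f r) (Set.Ioi 0) := by
  intro t ht
  have ht : 0 < t := ht
  -- This interval contains the base point `1` and a neighbourhood of `t`, and stays in the positive
  -- reals.
  have h1 : min 1 (t / 2) ≤ max 1 (t + 1) := (min_le_left _ _).trans (le_max_left _ _)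
  have hc := intervalIntegral.continuousOn_primitive_interval'
    (hf (min 1 (t / 2)) (max 1 (t + 1)) (by positivity) (by positivity))
    (a := 1) (by rw [Set.uIcc_of_le h1]; exact ⟨min_le_left _ _, le_max_left _ _⟩)
  refine (hc.continuousAt ?_).continuousWithinAt
  rw [Set.uIcc_of_le h1]
  exact Icc_mem_nhds (lt_of_le_of_lt (min_le_right _ _) (by linarith))
    (lt_of_lt_of_le (by linarith) (le_max_right _ _))

theorem contDiffOn_slidingIntegral_of_primitive {f : ℝ → W}
    (hf : ∀ a b : ℝ, 0 < a → 0 < b → IntervalIntegrable f MeasureTheory.volume a b)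
    {h : ℝ} (hh : 0 < h) {N : ℕ}
    (hp : ContDiffOn ℝ N (fun t => ∫ r in (1 : ℝ)..t, f r) (Set.Ioi 0)) :
    ContDiffOn ℝ N (slidingIntegral h f) (Set.Ioi 0) := by
  have h1 : ContDiffOn ℝ N (fun t => ∫ r in (1 : ℝ)..(t + h), f r) (Set.Ioi 0) :=
    hp.comp (g := fun t => ∫ r in (1 : ℝ)..t, f r) (f := fun t : ℝ => t + h)
      (contDiff_id.add contDiff_const).contDiffOn
      (fun t (ht : 0 < t) => show 0 < t + h by positivity)
  exact (h1.sub hp).congr fun t ht => slidingIntegral_eq_sub hf hh ht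

variable [CompleteSpace W] [NormedAddCommGroup E] [NormedSpace ℝ E] [CompleteSpace E]

theorem contDiffOn_primitive_Ioi {f : ℝ → W} {N : ℕ} (hf : ContDiffOn ℝ N f (Set.Ioi 0)) :
    ContDiffOn ℝ (N + 1 : ℕ) (fun t => ∫ r in (1 : ℝ)..t, f r) (Set.Ioi 0) := by
  have hfc : ContinuousOn f (Set.Ioi 0) := hf.continuousOn
  have hd : ∀ t ∈ Set.Ioi (0 : ℝ), HasDerivAt (fun t => ∫ r in (1 : ℝ)..t, f r) (f t) t := by
    intro t ht
    refine intervalIntegral.integral_hasDerivAt_right ?_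
      (hfc.stronglyMeasurableAtFilter isOpen_Ioi t ht) (hfc.continuousAt (Ioi_mem_nhds ht))
    refine (hfc.mono ?_).intervalIntegrable
    intro r hr
    exact lt_of_lt_of_le (lt_min one_pos ht) hr.1
  push_cast
  rw [contDiffOn_succ_iff_deriv_of_isOpen isOpen_Ioi]
  refine ⟨fun t ht => (hd t ht).differentiableAt.differentiableWithinAt, by simp, ?_⟩
  exact hf.congr fun t ht => (hd t ht).deriv

/-- A sliding average of a solution of `d/dt (T₁ σ) = T₂ σ` is again a solution. -/
theorem hasDerivAt_slidingIntegral (T₁ T₂ : W →L[ℝ] E) {σ : ℝ → W} {s : Set ℝ} (hs : s.Countable)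
    (hint : ∀ a b : ℝ, 0 < a → 0 < b → IntervalIntegrable σ MeasureTheory.volume a b)
    (hT : ContinuousOn (fun t => T₁ (σ t)) (Set.Ioi 0))
    (hd : ∀ t > 0, t ∉ s → HasDerivAt (fun t => T₁ (σ t)) (T₂ (σ t)) t)
    {h t : ℝ} (hh : 0 < h) (ht : 0 < t) :
    HasDerivAt (fun t => T₁ (slidingIntegral h σ t)) (T₂ (slidingIntegral h σ t)) t := by
  have hth : 0 < t + h := by positivity
  have hpos : ∀ x ∈ Set.uIcc t (t + h), 0 < x := fun x hx => lt_of_lt_of_le (lt_min ht hth) hx.1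
  have hTint := intervalIntegrable_of_continuousOn_Ioi hT
  -- Both sides of the averaged equation equal the increment of `T₁ σ` over the window; continuity
  -- of `T₁ σ` excludes jump terms.
  have e1 : T₂ (slidingIntegral h σ t) = T₁ (σ (t + h)) - T₁ (σ t) := by
    unfold slidingIntegral
    rw [← ContinuousLinearMap.intervalIntegral_comp_comm _ (hint _ _ ht hth)]
    have hi := hint _ _ ht hth
    refine MeasureTheory.integral_eq_of_hasDerivAt_off_countable (fun t => T₁ (σ t))
      (fun t => T₂ (σ t)) hs (hT.mono hpos) ?_ ⟨T₂.integrable_comp hi.1, T₂.integrable_comp hi.2⟩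
    intro x hx
    exact hd x (hpos x ⟨hx.1.1.le, hx.1.2.le⟩) hx.2
  have hprim : ∀ r > 0, HasDerivAt (fun t => ∫ r in (1 : ℝ)..t, T₁ (σ r)) (T₁ (σ r)) r :=
    fun r hr => intervalIntegral.integral_hasDerivAt_right (hTint _ _ one_pos hr)
      (hT.stronglyMeasurableAtFilter isOpen_Ioi r hr) (hT.continuousAt (Ioi_mem_nhds hr))
  rw [e1]
  have h2 := ((hprim _ hth).comp_add_const t h).sub (hprim t ht)
  refine h2.congr_of_eventuallyEq ?_
  filter_upwards [Ioi_mem_nhds ht] with r hr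
  have hr : 0 < r := hr
  unfold slidingIntegral
  rw [← ContinuousLinearMap.intervalIntegral_comp_comm _ (hint _ _ hr (by positivity))]
  exact slidingIntegral_eq_sub hTint hh hr

/-- As a function of the width `h`, the window integral has derivative `σ t` at `h = 0`. A nonzero
derivative of its image under `ℓ` forces nonvanishing for small `h > 0`. -/
theorem eventually_slidingIntegral_ne_zero {σ : ℝ → W}
    (hint : ∀ a b : ℝ, 0 < a → 0 < b → IntervalIntegrable σ MeasureTheory.volume a b)
    (ℓ : W →L[ℝ] ℝ) {t : ℝ} (ht : 0 < t) (hc : ContinuousAt σ t) (h0 : ℓ (σ t) ≠ 0) :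
    ∀ᶠ h in 𝓝[>] (0 : ℝ), ℓ (slidingIntegral h σ t) ≠ 0 := by
  have hmeas : StronglyMeasurableAtFilter σ (𝓝 t) MeasureTheory.volume :=
    ⟨Set.Ioc (t / 2) (t + 1), Ioc_mem_nhds (by linarith) (by linarith),
      (hint (t / 2) (t + 1) (by positivity) (by positivity)).aestronglyMeasurable⟩
  have h1 : HasDerivAt (fun r => ∫ x in t..r, σ x) (σ t) (t + 0) := by
    rw [add_zero]
    exact intervalIntegral.integral_hasDerivAt_right (hint t t ht ht) hmeas hc
  have h2 := ℓ.hasFDerivAt.comp_hasDerivAt (0 : ℝ) (h1.comp_const_add t 0)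
  refine (h2.eventually_ne (c := 0) h0).filter_mono (nhdsWithin_mono _ ?_)
  intro h hh
  exact ne_of_gt hh

/-- A piecewise continuous solution of a linear constant coefficient system can be replaced by an
arbitrarily smooth one that satisfies the same linear constraints. -/
theorem exists_contDiffOn_solution (T₁ T₂ : W →L[ℝ] E) {σ : ℝ → W} {s : Set ℝ} (hs : s.Countable)
    (hcont : ∀ t > 0, t ∉ s → ContinuousAt σ t)
    (hint : ∀ a b : ℝ, 0 < a → 0 < b → IntervalIntegrable σ MeasureTheory.volume a b)
    (hT : ContinuousOn (fun t => T₁ (σ t)) (Set.Ioi 0))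
    (hd : ∀ t > 0, t ∉ s → HasDerivAt (fun t => T₁ (σ t)) (T₂ (σ t)) t)
    {ι : Type*} (F : Finset ι) (ℓ : ι → W →L[ℝ] ℝ)
    (hℓ : ∀ i ∈ F, ∃ t > 0, t ∉ s ∧ ℓ i (σ t) ≠ 0) (N : ℕ) :
    ∃ τ : ℝ → W, ContDiffOn ℝ N τ (Set.Ioi 0) ∧
      (∀ t > 0, HasDerivAt (fun t => T₁ (τ t)) (T₂ (τ t)) t) ∧
      (∀ R : W →L[ℝ] ℝ, (∀ t > 0, R (σ t) = 0) → ∀ t > 0, R (τ t) = 0) ∧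
      ∀ i ∈ F, ∃ t > 0, ℓ i (τ t) ≠ 0 := by
  have step : ∀ (σ : ℝ → W) (s : Set ℝ), s.Countable →
      (∀ t > 0, t ∉ s → ContinuousAt σ t) →
      (∀ a b : ℝ, 0 < a → 0 < b → IntervalIntegrable σ MeasureTheory.volume a b) →
      ContinuousOn (fun t => T₁ (σ t)) (Set.Ioi 0) →
      (∀ t > 0, t ∉ s → HasDerivAt (fun t => T₁ (σ t)) (T₂ (σ t)) t) →
      (∀ i ∈ F, ∃ t > 0, t ∉ s ∧ ℓ i (σ t) ≠ 0) →
      ∀ N : ℕ, ContDiffOn ℝ N (fun t => ∫ r in (1 : ℝ)..t, σ r) (Set.Ioi 0) →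
      ∃ τ : ℝ → W, ContDiffOn ℝ N τ (Set.Ioi 0) ∧
        (∀ t > 0, HasDerivAt (fun t => T₁ (τ t)) (T₂ (τ t)) t) ∧
        (∀ R : W →L[ℝ] ℝ, (∀ t > 0, R (σ t) = 0) → ∀ t > 0, R (τ t) = 0) ∧
        ∀ i ∈ F, ∃ t > 0, ℓ i (τ t) ≠ 0 := by
    intro σ s hs hcont hint hT hd hℓ N hp
    choose! c hc0 hcs hcne using hℓ
    -- Finiteness of `F` allows one window width to serve all the functionals.
    have hev : ∀ᶠ h in 𝓝[>] (0 : ℝ), ∀ i ∈ F, ℓ i (slidingIntegral h σ (c i)) ≠ 0 :=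
      (Filter.eventually_all_finset F).mpr fun i hi =>
        eventually_slidingIntegral_ne_zero hint (ℓ i) (hc0 i hi)
          (hcont _ (hc0 i hi) (hcs i hi)) (hcne i hi)
    obtain ⟨h, hne, hh⟩ := (hev.and self_mem_nhdsWithin).exists
    have hh : 0 < h := hh
    refine ⟨slidingIntegral h σ, contDiffOn_slidingIntegral_of_primitive hint hh hp,
      fun t ht => hasDerivAt_slidingIntegral T₁ T₂ hs hint hT hd hh ht, ?_,
      fun i hi => ⟨c i, hc0 i hi, hne i hi⟩⟩
    intro R hR t ht
    have hth : 0 < t + h := by positivity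
    unfold slidingIntegral
    rw [← ContinuousLinearMap.intervalIntegral_comp_comm _ (hint _ _ ht hth)]
    rw [intervalIntegral.integral_congr (g := fun _ => (0 : ℝ)), intervalIntegral.integral_zero]
    intro x hx
    exact hR x (lt_of_lt_of_le (lt_min ht hth) hx.1)
  induction N with
  | zero =>
    refine step σ s hs hcont hint hT hd hℓ 0 ?_
    simpa using continuousOn_primitive_Ioi hint
  | succ N ih =>
    obtain ⟨τ, hτ, hτd, hτR, hτne⟩ := ih
    have hτc : ContinuousOn τ (Set.Ioi 0) := hτ.continuousOn
    -- After the first averaging the signal is continuous and solves the equation everywhere, so the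
    -- exceptional set is empty. Each further round gains one derivative.
    obtain ⟨ρ, h1, h2, h3, h4⟩ := step τ ∅ Set.countable_empty
      (fun t ht _ => hτc.continuousAt (Ioi_mem_nhds ht))
      (intervalIntegrable_of_continuousOn_Ioi hτc) (T₁.continuous.comp_continuousOn hτc)
      (fun t ht _ => hτd t ht)
      (fun i hi => (hτne i hi).imp fun t ht => ⟨ht.1, Set.notMem_empty _, ht.2⟩) (N + 1)
      (contDiffOn_primitive_Ioi hτ)
    exact ⟨ρ, h1, h2, fun R hR => h3 R (hτR R hR), h4⟩

end Averages

/-- Uniqueness for the linear equation `e' = F e`, `e 0 = 0`, the equation being required outside a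
countable set only. -/
theorem eq_zero_of_hasDerivAt_off_countable {E : Type*} [NormedAddCommGroup E] [NormedSpace ℝ E]
    [CompleteSpace E] (F : E →L[ℝ] E) {e : ℝ → E} {s : Set ℝ} (hs : s.Countable)
    (hc : ContinuousOn e (Set.Ici 0)) (hd : ∀ t > 0, t ∉ s → HasDerivAt e (F (e t)) t)
    (h0 : e 0 = 0) : ∀ t ≥ 0, e t = 0 := by
  have hFc : ContinuousOn (fun t => F (e t)) (Set.Ici 0) := F.continuous.comp_continuousOn hc
  have hint : ∀ t ≥ 0, IntervalIntegrable (fun t => F (e t)) MeasureTheory.volume 0 t := by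
    intro t ht
    refine (hFc.mono ?_).intervalIntegrable
    rw [Set.uIcc_of_le ht]
    exact fun r hr => hr.1
  have hprim : ∀ t ≥ 0, e t = ∫ r in (0 : ℝ)..t, F (e r) := by
    intro t ht
    rw [MeasureTheory.integral_eq_of_hasDerivAt_off_countable e (fun t => F (e t)) hs ?_ ?_
      (hint t ht), h0, sub_zero]
    · rw [Set.uIcc_of_le ht]
      exact hc.mono fun r hr => hr.1
    · intro r hr
      rw [min_eq_left ht] at hr
      exact hd r hr.1.1 hr.2
  intro T hT
  -- The integral form has a continuous integrand, so the right derivative exists at the exceptional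
  -- times as well, and uniqueness for Lipschitz equations applies.
  have hder : ∀ t ∈ Set.Ico 0 T, HasDerivWithinAt e (F (e t)) (Set.Ici t) t := by
    intro t ht
    have h1 : HasDerivWithinAt (fun t => ∫ r in (0 : ℝ)..t, F (e r)) (F (e t)) (Set.Ici t) t := by
      refine intervalIntegral.integral_hasDerivWithinAt_right (hint t ht.1) (t := Set.Ioi t) ?_
        ((hFc t ht.1).mono (Set.Ioi_subset_Ici ht.1))
      exact ⟨Set.Ioi t, self_mem_nhdsWithin,
        (hFc.mono (Set.Ioi_subset_Ici ht.1)).aestronglyMeasurable measurableSet_Ioi⟩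
    exact h1.congr (fun r hr => hprim r (ht.1.trans hr)) (hprim t ht.1)
  have huniq := ODE_solution_unique_of_mem_Icc_right (v := fun _ x => F x) (K := ‖F‖₊)
    (s := fun _ => Set.univ) (f := e) (g := fun _ => 0) (a := 0) (b := T)
    (fun t _ => F.lipschitz.lipschitzOnWith) (hc.mono fun r hr => hr.1) hder
    (fun _ _ => Set.mem_univ _) continuousOn_const
    (fun t _ => by simpa using hasDerivWithinAt_const t (Set.Ici t) (0 : E))
    (fun _ _ => Set.mem_univ _) h0
  exact huniq ⟨hT, le_rfl⟩

/-! ### Smooth steering along the conditioned invariant subspace algorithm -/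

section Steering

/-- Split the surjection `p → p.map f` and extend the splitting to all of `F`. A linear choice of
preimages is what keeps smooth signals smooth. -/
theorem LinearMap.exists_inverse_on_map {K E F : Type*} [Field K] [AddCommGroup E] [Module K E]
    [AddCommGroup F] [Module K F] (f : E →ₗ[K] F) (p : Submodule K E) :
    ∃ L : F →ₗ[K] E, (∀ y, L y ∈ p) ∧ ∀ y ∈ p.map f, f (L y) = y := by
  obtain ⟨g, hg⟩ := LinearMap.exists_rightInverse_of_surjective (f.submoduleMap p)
    (LinearMap.range_eq_top.mpr (f.submoduleMap_surjective p))
  obtain ⟨h, hh⟩ := LinearMap.exists_extend g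
  refine ⟨p.subtype ∘ₗ h, fun y => (h y).2, fun y hy => ?_⟩
  have h1 : h y = g ⟨y, hy⟩ := LinearMap.congr_fun hh ⟨y, hy⟩
  have h2 := congrArg Subtype.val (LinearMap.congr_fun hg ⟨y, hy⟩)
  simpa [h1] using h2

theorem LinearMap.exists_inverse_mod {K E : Type*} [Field K] [AddCommGroup E] [Module K E]
    (f : E →ₗ[K] E) (b p : Submodule K E) :
    ∃ L : E →ₗ[K] E, (∀ y, L y ∈ p) ∧ ∀ y ∈ b ⊔ p.map f, y - f (L y) ∈ b := by
  obtain ⟨h, hp, hh⟩ := LinearMap.exists_inverse_on_map (b.mkQ ∘ₗ f) p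
  refine ⟨h ∘ₗ b.mkQ, fun y => hp _, fun y hy => ?_⟩
  obtain ⟨c, hc, d, ⟨e, he, rfl⟩, rfl⟩ := Submodule.mem_sup.mp hy
  rw [← Submodule.Quotient.eq, eq_comm]
  refine hh (b.mkQ (c + f e)) ⟨e, he, ?_⟩
  simp [(Submodule.Quotient.mk_eq_zero b).mpr hc]

variable {E F : Type*} [NormedAddCommGroup E] [NormedSpace ℝ E]
  [NormedAddCommGroup F] [NormedSpace ℝ F]

/-- One step of the conditioned invariant subspace algorithm. -/
def conditionedStep (a : E →ₗ[ℝ] E) (c : E →ₗ[ℝ] F) (b S : Submodule ℝ E) : Submodule ℝ E :=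
  b ⊔ (S ⊓ LinearMap.ker c).map a

theorem conditionedStep_mono (a : E →ₗ[ℝ] E) (c : E →ₗ[ℝ] F) (b : Submodule ℝ E) :
    Monotone (conditionedStep a c b) := fun _ _ h =>
  sup_le_sup_left (Submodule.map_mono (inf_le_inf_right _ h)) _

theorem le_conditionedStep_iterate (a : E →ₗ[ℝ] E) (c : E →ₗ[ℝ] F) (b : Submodule ℝ E) (k : ℕ) :
    b ≤ (conditionedStep a c b)^[k] b := by
  cases k with
  | zero => exact le_rfl
  | succ k => rw [Function.iterate_succ_apply']; exact le_sup_left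

theorem ContDiffOn.hasDerivAt_Ioi {f : ℝ → F} {N : ℕ} (hf : ContDiffOn ℝ (N + 1 : ℕ) f (Set.Ioi 0))
    {t : ℝ} (ht : 0 < t) : HasDerivAt f (deriv f t) t :=
  ((hf.differentiableOn (by simp)).differentiableAt (Ioi_mem_nhds ht)).hasDerivAt

theorem ContDiffOn.deriv_Ioi {f : ℝ → F} {N : ℕ} (hf : ContDiffOn ℝ (N + 1 : ℕ) f (Set.Ioi 0)) :
    ContDiffOn ℝ N (deriv f) (Set.Ioi 0) := by
  push_cast at hf
  exact ((contDiffOn_succ_iff_deriv_of_isOpen isOpen_Ioi).mp hf).2.2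

variable [FiniteDimensional ℝ E]

theorem LinearMap.contDiffOn_comp_real (L : E →ₗ[ℝ] F) {f : ℝ → E} {s : Set ℝ} {N : WithTop ℕ∞}
    (hf : ContDiffOn ℝ N f s) : ContDiffOn ℝ N (fun t => L (f t)) s :=
  (LinearMap.toContinuousLinearMap L).contDiff.comp_contDiffOn hf

theorem LinearMap.hasDerivAt_comp_real (L : E →ₗ[ℝ] F) {f : ℝ → E} {f' : E} {t : ℝ}
    (hf : HasDerivAt f f' t) : HasDerivAt (fun t => L (f t)) (L f') t :=
  (LinearMap.toContinuousLinearMap L).hasFDerivAt.comp_hasDerivAt t hf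

/-- The iterates from `b` increase, hence stabilise in finite dimension. -/
theorem exists_conditionedStep_iterate_fixed (a : E →ₗ[ℝ] E) (c : E →ₗ[ℝ] F)
    (b : Submodule ℝ E) : ∃ k, (((conditionedStep a c b)^[k] b) ⊓ LinearMap.ker c).map a
      ≤ (conditionedStep a c b)^[k] b := by
  have hm := (conditionedStep_mono a c b).monotone_iterate_of_le_map
    (x := b) (le_conditionedStep_iterate a c b 1)
  obtain ⟨k, hk⟩ := (monotone_stabilizes_iff_noetherian (R := ℝ) (M := E)).mpr inferInstance
    ⟨fun k => (conditionedStep a c b)^[k] b, hm⟩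
  refine ⟨k, ?_⟩
  have h1 : (conditionedStep a c b)^[k] b = (conditionedStep a c b)^[k + 1] b :=
    hk (k + 1) k.le_succ
  conv_rhs => rw [h1, Function.iterate_succ_apply']
  exact le_sup_right

/-- Let `S_k` be the `k`-th iterate and let the defect `e = z' - a z - g` lie in `S_{k+1} = b + a
(S_k ∩ ker c)`. Choose `L e` in `S_k ∩ ker c` with `e - a (L e)` in `b`. Replacing `z` by `z + L e`
leaves `c z` unchanged and turns the defect into `(e - a (L e)) + L e'`, which lies in `S_k`. Each
stage costs one derivative, so a `C^{k+1}` start ends in `C^1`. -/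
theorem exists_steering (a : E →ₗ[ℝ] E) (c : E →ₗ[ℝ] F) (b : Submodule ℝ E) {g : ℝ → E}
    {q : ℝ → F} (k : ℕ) (hg : ContDiffOn ℝ k g (Set.Ioi 0))
    (hz : ∃ z : ℝ → E, ContDiffOn ℝ (k + 1 : ℕ) z (Set.Ioi 0) ∧ (∀ t > 0, c (z t) = q t) ∧
      ∀ t > 0, deriv z t - a (z t) - g t ∈ (conditionedStep a c b)^[k] b) :
    ∃ z : ℝ → E, ContDiffOn ℝ (1 : ℕ) z (Set.Ioi 0) ∧ (∀ t > 0, c (z t) = q t) ∧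
      ∀ t > 0, deriv z t - a (z t) - g t ∈ b := by
  induction k with
  | zero => simpa using hz
  | succ k ih =>
    refine ih (hg.of_le (by exact_mod_cast k.le_succ)) ?_
    obtain ⟨z, hz, hq, hs⟩ := hz
    have hz1 : ContDiffOn ℝ (k + 1 : ℕ) z (Set.Ioi 0) :=
      hz.of_le (by exact_mod_cast (k + 1).le_succ)
    set e : ℝ → E := fun t => deriv z t - a (z t) - g t with he
    have hec : ContDiffOn ℝ (k + 1 : ℕ) e (Set.Ioi 0) :=
      (hz.deriv_Ioi.sub (a.contDiffOn_comp_real hz1)).sub hg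
    set S := (conditionedStep a c b)^[k] b with hS
    obtain ⟨L, hL, hLb⟩ := LinearMap.exists_inverse_mod a b (S ⊓ LinearMap.ker c)
    refine ⟨fun t => z t + L (e t), hz1.add (L.contDiffOn_comp_real hec), ?_, ?_⟩
    · intro t ht
      rw [map_add, hq t ht, LinearMap.mem_ker.mp (hL (e t)).2, add_zero]
    · intro t ht
      have hd := (hz1.hasDerivAt_Ioi ht).add (L.hasDerivAt_comp_real (hec.hasDerivAt_Ioi ht))
      rw [show deriv (fun t => z t + L (e t)) t = _ from hd.deriv]
      have h1 : deriv z t + L (deriv e t) - a (z t + L (e t)) - g t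
          = (e t - a (L (e t))) + L (deriv e t) := by
        have h2 : deriv z t = e t + a (z t) + g t := by simp only [he]; abel
        rw [map_add, h2]; abel
      rw [h1]
      refine S.add_mem (le_conditionedStep_iterate a c b k (hLb _ ?_)) (hL _).1
      have h2 := hs t ht
      rwa [Function.iterate_succ_apply'] at h2

end Steering

/-! ### The filter -/

theorem Matrix.hasDerivAt_mulVec {X Y : Type*} [Fintype X] [Fintype Y] (A : Matrix Y X ℝ)
    {z : ℝ → X → ℝ} {z' : X → ℝ} {t : ℝ} (h : HasDerivAt z z' t) :
    HasDerivAt (fun t => A *ᵥ z t) (A *ᵥ z') t :=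
  A.mulVecLin.hasDerivAt_comp_real h

theorem Matrix.contDiffOn_mulVec {X Y : Type*} [Fintype X] [Fintype Y] (A : Matrix Y X ℝ)
    {z : ℝ → X → ℝ} {s : Set ℝ} {N : WithTop ℕ∞} (h : ContDiffOn ℝ N z s) :
    ContDiffOn ℝ N (fun t => A *ᵥ z t) s :=
  A.mulVecLin.contDiffOn_comp_real h

theorem Matrix.continuousOn_mulVec {X Y : Type*} [Fintype X] [Fintype Y] (A : Matrix Y X ℝ)
    {z : ℝ → X → ℝ} {s : Set ℝ} (h : ContinuousOn z s) :
    ContinuousOn (fun t => A *ᵥ z t) s :=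
  (A.mulVecLin.continuous_of_finiteDimensional).comp_continuousOn h

namespace IdentificationFilter

variable {X U : Type*} [Fintype X] [DecidableEq X] [Fintype U] [DecidableEq U] {p : ℕ}
  {A : Matrix X X ℝ} {B : Matrix X U ℝ} {C : Matrix (Fin p) X ℝ} {D : Matrix (Fin p) U ℝ}
  (Φ : IdentificationFilter A B C D)

/-- The state matrix after the measurements in `Im D` are used to cancel the input. -/
noncomputable def decoupledA : Matrix X X ℝ := A - B * pinv (Φ.V * D) * Φ.V * C

/-- The inputs that do not reach the measurements directly. -/
noncomputable def hiddenB (_ : IdentificationFilter A B C D) : Matrix X U ℝ :=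
  B * (1 - pinv D * D)

theorem Q_mulVec_D (x : U → ℝ) : Φ.Q *ᵥ (D *ᵥ x) = 0 := by
  funext i
  exact (Φ.span_Q (Φ.Q.row i)).mp (Submodule.subset_span ⟨i, rfl⟩) _ ⟨x, rfl⟩

/-- `V x = 0` makes `x` orthogonal to `Im D`, hence a combination of the rows of `Q`. Then `Q x = 0`
makes `x` orthogonal to itself. -/
theorem eq_zero_of_V_of_Q {x : Fin p → ℝ} (hV : Φ.V *ᵥ x = 0) (hQ : Φ.Q *ᵥ x = 0) : x = 0 := by
  have key : ∀ {k : ℕ} (R : Matrix (Fin k) (Fin p) ℝ), R *ᵥ x = 0 →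
      ∀ y ∈ Submodule.span ℝ (Set.range R.row), x ⬝ᵥ y = 0 := by
    intro k R hR y hy
    induction hy using Submodule.span_induction with
    | mem y hy =>
      obtain ⟨i, rfl⟩ := hy
      rw [dotProduct_comm]
      exact congrFun hR i
    | zero => simp
    | add y z _ _ hy hz => rw [dotProduct_add, hy, hz, add_zero]
    | smul c y _ hy => rw [dotProduct_smul, hy, smul_zero]
  have h1 := (Φ.span_Q x).mpr fun y hy => key Φ.V hV y (Φ.span_V ▸ hy)
  exact dotProduct_self_eq_zero.mp (key Φ.Q hQ x h1)

/-- The rows of `V` lie in `Im D` and are orthonormal, so `V * D` has a right inverse; cancelling it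
in the first Penrose equation gives the claim. -/
theorem VD_mul_pinv : Φ.V * D * pinv (Φ.V * D) = 1 := by
  have h1 : Φ.V * Φ.Vᵀ = 1 := by
    have h := Φ.orthonormal_VQ
    rw [transpose_fromRows, fromRows_mul_fromCols, ← fromBlocks_one] at h
    exact (fromBlocks_inj.mp h).1
  have hrow : ∀ i, ∃ x : U → ℝ, D *ᵥ x = Φ.V.row i := fun i => by
    have h : Φ.V.row i ∈ LinearMap.range D.mulVecLin :=
      Φ.span_V ▸ Submodule.subset_span ⟨i, rfl⟩
    exact h
  choose W hW using hrow
  have h2 : D * (Matrix.of W)ᵀ = Φ.Vᵀ := by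
    ext i j
    exact congrFun (hW j) i
  have h3 : Φ.V * D * (Matrix.of W)ᵀ = 1 := by rw [Matrix.mul_assoc, h2, h1]
  calc Φ.V * D * pinv (Φ.V * D)
      = Φ.V * D * pinv (Φ.V * D) * (Φ.V * D * (Matrix.of W)ᵀ) := by rw [h3, Matrix.mul_one]
    _ = (Φ.V * D * pinv (Φ.V * D) * (Φ.V * D)) * (Matrix.of W)ᵀ := by
        simp only [Matrix.mul_assoc]
    _ = 1 := by rw [(pinv_spec (Φ.V * D)).mul_mul_left, h3]

theorem VD_mulVec_pinv (x : Fin Φ.v → ℝ) : Φ.V *ᵥ (D *ᵥ (pinv (Φ.V * D) *ᵥ x)) = x := by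
  rw [mulVec_mulVec, mulVec_mulVec, Φ.VD_mul_pinv, one_mulVec]

theorem hiddenB_mem (x : U → ℝ) : Φ.hiddenB *ᵥ x ∈ Φ.S := by
  rw [Φ.S_eq]
  exact (smallestConditionedInvariant_isLeast _ _ _).1.2 ⟨x, rfl⟩

theorem P_mulVec_eq_zero_iff {x : X → ℝ} : Φ.P *ᵥ x = 0 ↔ x ∈ Φ.S := by
  rw [← Φ.ker_P, LinearMap.mem_ker, mulVecLin_apply]

/-- The output injection leaves `S` invariant and `x - Pᵀ P x` lies in `S`, so the injected matrix
descends to `AK` on the quotient. -/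
theorem P_mulVec_injected (x : X → ℝ) :
    Φ.P *ᵥ (Φ.decoupledA *ᵥ x + Φ.J *ᵥ (Φ.Q *ᵥ (C *ᵥ x))) = Φ.AK *ᵥ (Φ.P *ᵥ x) := by
  have h1 : x - Φ.Pᵀ *ᵥ (Φ.P *ᵥ x) ∈ Φ.S := by
    rw [← Φ.P_mulVec_eq_zero_iff, mulVec_sub, mulVec_mulVec _ Φ.P, Φ.orthonormal_P,
      one_mulVec, sub_self]
  have h2 := Φ.P_mulVec_eq_zero_iff.mpr (Φ.J_spec (Submodule.mem_map_of_mem h1))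
  rw [mulVecLin_apply, mulVec_sub, mulVec_sub, sub_eq_zero] at h2
  simp only [AK, ← mulVec_mulVec]
  rw [← h2, decoupledA, add_mulVec, ← mulVec_mulVec, ← mulVec_mulVec]

/-- Subtracting `(V D)† V D u` from `u` leaves an input in `ker D`, on which `B` and `hiddenB`
agree. The subtracted part is recovered from the output. -/
theorem exists_hidden_input (z : X → ℝ) (u : U → ℝ) :
    ∃ v, A *ᵥ z + B *ᵥ u
      = Φ.decoupledA *ᵥ z + Φ.BZ *ᵥ (Φ.V *ᵥ (C *ᵥ z + D *ᵥ u)) + Φ.hiddenB *ᵥ v := by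
  set v := u - pinv (Φ.V * D) *ᵥ (Φ.V *ᵥ (D *ᵥ u)) with hv
  have hD : D *ᵥ v = 0 := by
    refine Φ.eq_zero_of_V_of_Q ?_ (Φ.Q_mulVec_D v)
    rw [hv, mulVec_sub, mulVec_sub, Φ.VD_mulVec_pinv, sub_self]
  refine ⟨v, ?_⟩
  have h1 : Φ.hiddenB *ᵥ v = B *ᵥ v := by
    rw [hiddenB, ← mulVec_mulVec, sub_mulVec, one_mulVec, ← mulVec_mulVec, hD, mulVec_zero,
      sub_zero]
  rw [h1, hv, decoupledA, BZ]
  simp only [mulVec_sub, mulVec_add, sub_mulVec, ← mulVec_mulVec]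
  abel

theorem M_mulVec_P (z : X → ℝ) : Φ.M *ᵥ (Φ.P *ᵥ z) = Φ.H *ᵥ (Φ.Q *ᵥ (C *ᵥ z)) := by
  rw [mulVec_mulVec, ← Φ.M_spec, ← mulVec_mulVec, ← mulVec_mulVec]

/-- The residual vanishes if the measurements are generated by the candidate input set. -/
theorem residual_eq_zero {u : ℝ → U → ℝ} {z : ℝ → X → ℝ} {y : ℝ → Fin p → ℝ}
    {w : ℝ → Fin Φ.s → ℝ} {s : Set ℝ} (hs : s.Countable) (hz : ContinuousOn z (Set.Ici 0))
    (hd : ∀ t > 0, t ∉ s → HasDerivAt z (A *ᵥ z t + B *ᵥ u t) t)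
    (hy : ∀ t ≥ 0, y t = C *ᵥ z t + D *ᵥ u t)
    (hyc : ∀ t > 0, t ∉ s → ContinuousAt y t) (hw : Φ.IsResponse (z 0) y w) :
    ∀ t ≥ 0, Φ.residual y w t = 0 := by
  obtain ⟨hw0, hwc, hwd⟩ := hw
  have hQ : ∀ t ≥ 0, Φ.Q *ᵥ y t = Φ.Q *ᵥ (C *ᵥ z t) := fun t ht => by
    rw [hy t ht, mulVec_add, Φ.Q_mulVec_D, add_zero]
  -- The error equation is autonomous: `P` annihilates the hidden inputs, and `Q y = Q C z` makes
  -- the `J` and `G` terms match.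
  have key : ∀ t ≥ 0, Φ.P *ᵥ z t - w t = 0 := by
    refine eq_zero_of_hasDerivAt_off_countable
      (LinearMap.toContinuousLinearMap (Φ.AK + Φ.G * Φ.M).mulVecLin) hs
      ((Matrix.continuousOn_mulVec _ hz).sub hwc) (fun t ht hts => ?_) (by rw [hw0, sub_self])
    have h1 := (Matrix.hasDerivAt_mulVec Φ.P (hd t ht hts)).sub (hwd t ht (hyc t ht hts))
    refine h1.congr_deriv ?_
    obtain ⟨v, hv⟩ := Φ.exists_hidden_input (z t) (u t)
    have h2 := Φ.P_mulVec_injected (z t)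
    rw [mulVec_add] at h2
    rw [hv, ← hy t ht.le]
    simp only [LinearMap.coe_toContinuousLinearMap', mulVecLin_apply, mulVec_sub, mulVec_add,
      add_mulVec, sub_mulVec, ← mulVec_mulVec, ← h2, hQ t ht.le, Φ.M_mulVec_P,
      Φ.P_mulVec_eq_zero_iff.mpr (Φ.hiddenB_mem v)]
    abel
  intro t ht
  rw [residual, ← mulVec_mulVec, hQ t ht, ← Φ.M_mulVec_P, ← mulVec_sub, ← neg_sub, key t ht,
    neg_zero, mulVec_zero]

theorem exists_S_le_iterate :
    ∃ k, Φ.S ≤ (conditionedStep Φ.decoupledA.mulVecLin (Φ.Q * C).mulVecLin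
      (LinearMap.range Φ.hiddenB.mulVecLin))^[k] (LinearMap.range Φ.hiddenB.mulVecLin) := by
  obtain ⟨k, hk⟩ := exists_conditionedStep_iterate_fixed Φ.decoupledA.mulVecLin
    (Φ.Q * C).mulVecLin (LinearMap.range Φ.hiddenB.mulVecLin)
  refine ⟨k, ?_⟩
  conv_lhs => rw [Φ.S_eq]
  exact (smallestConditionedInvariant_isLeast _ _ _).2 ⟨hk, le_conditionedStep_iterate _ _ _ k⟩

/-- `ker_H` writes `q = Q C v`; then `ker_HQC` splits `v` into a part in `S` and a part that `Q C`
annihilates. -/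
theorem mem_map_S_of_H_eq_zero {q : Fin Φ.q → ℝ} (hq : Φ.H *ᵥ q = 0) :
    q ∈ Φ.S.map (Φ.Q * C).mulVecLin := by
  obtain ⟨v, rfl⟩ := Φ.ker_H (show q ∈ LinearMap.ker Φ.H.mulVecLin from hq)
  have h1 : v ∈ LinearMap.ker (Φ.H * Φ.Q * C).mulVecLin := by
    rw [LinearMap.mem_ker, mulVecLin_apply, Matrix.mul_assoc, ← mulVec_mulVec]
    exact hq
  rw [Φ.ker_HQC] at h1
  obtain ⟨x, hx, y, hy, rfl⟩ := Submodule.mem_sup.mp h1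
  exact ⟨x, hx, by rw [map_add, LinearMap.mem_ker.mp hy, add_zero]⟩

/-- If the residual of sufficiently smooth measurements vanishes, the measurements can be generated
by the candidate input set. -/
theorem exists_input_of_residual_eq_zero : ∃ N : ℕ, ∀ (y : ℝ → Fin p → ℝ) (w : ℝ → Fin Φ.s → ℝ),
    ContDiffOn ℝ N y (Set.Ioi 0) → ContDiffOn ℝ N w (Set.Ioi 0) →
    (∀ t > 0, HasDerivAt w ((Φ.AK + Φ.G * Φ.M) *ᵥ w t
      + (Φ.P * Φ.BZ * Φ.V - (Φ.P * Φ.J + Φ.G * Φ.H) * Φ.Q) *ᵥ y t) t) →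
    (∀ t > 0, Φ.residual y w t = 0) →
    ∃ (z : ℝ → X → ℝ) (u : ℝ → U → ℝ), ContinuousOn u (Set.Ioi 0) ∧
      (∀ t > 0, HasDerivAt z (A *ᵥ z t + B *ᵥ u t) t) ∧
      ∀ t > 0, y t = C *ᵥ z t + D *ᵥ u t := by
  obtain ⟨k, hk⟩ := Φ.exists_S_le_iterate
  refine ⟨k + 1, fun y w hy hw hwd hr => ?_⟩
  have hr' : ∀ t > 0, Φ.M *ᵥ w t = Φ.H *ᵥ (Φ.Q *ᵥ y t) := fun t ht => by
    have h := hr t ht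
    rwa [residual, sub_eq_zero, ← mulVec_mulVec] at h
  obtain ⟨L, hLS, hL⟩ := LinearMap.exists_inverse_on_map (Φ.Q * C).mulVecLin Φ.S
  set g : ℝ → X → ℝ := fun t => Φ.BZ *ᵥ (Φ.V *ᵥ y t) with hgdef
  have hg : ContDiffOn ℝ k g (Set.Ioi 0) :=
    (Matrix.contDiffOn_mulVec _ (Matrix.contDiffOn_mulVec _ hy)).of_le
      (by exact_mod_cast k.le_succ)
  have hPP : ∀ x, Φ.P *ᵥ (Φ.Pᵀ *ᵥ x) = x := fun x => by
    rw [mulVec_mulVec, Φ.orthonormal_P, one_mulVec]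
  have hstart : ∃ z : ℝ → X → ℝ, ContDiffOn ℝ (k + 1 : ℕ) z (Set.Ioi 0) ∧
      (∀ t > 0, (Φ.Q * C).mulVecLin (z t) = Φ.Q *ᵥ y t) ∧
      ∀ t > 0, deriv z t - Φ.decoupledA.mulVecLin (z t) - g t ∈ Φ.S := by
    -- `Pᵀ w` lifts the filter state. The correction takes values in `S`, so it preserves `P z = w`
    -- while matching `Q C z` to `Q y`.
    set z : ℝ → X → ℝ := fun t => Φ.Pᵀ *ᵥ w t
      + L (Φ.Q *ᵥ y t - (Φ.Q * C) *ᵥ (Φ.Pᵀ *ᵥ w t)) with hzdef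
    have hz : ContDiffOn ℝ (k + 1 : ℕ) z (Set.Ioi 0) :=
      (Matrix.contDiffOn_mulVec _ hw).add (L.contDiffOn_comp_real
        ((Matrix.contDiffOn_mulVec _ hy).sub
          (Matrix.contDiffOn_mulVec _ (Matrix.contDiffOn_mulVec _ hw))))
    have hPz : ∀ t, Φ.P *ᵥ z t = w t := fun t => by
      rw [hzdef, mulVec_add, hPP, Φ.P_mulVec_eq_zero_iff.mpr (hLS _), add_zero]
    have hqz : ∀ t > 0, (Φ.Q * C).mulVecLin (z t) = Φ.Q *ᵥ y t := fun t ht => by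
      have h1 : Φ.Q *ᵥ y t - (Φ.Q * C) *ᵥ (Φ.Pᵀ *ᵥ w t) ∈ Φ.S.map (Φ.Q * C).mulVecLin := by
        apply Φ.mem_map_S_of_H_eq_zero
        rw [mulVec_sub, ← hr' t ht, ← mulVec_mulVec, ← Φ.M_mulVec_P, hPP, sub_self]
      rw [hzdef, map_add, hL _ h1, mulVecLin_apply, add_sub_cancel]
    refine ⟨z, hz, hqz, fun t ht => ?_⟩
    rw [← Φ.P_mulVec_eq_zero_iff]
    -- Since `P z = w`, the derivative comes from the filter equation; its `G` terms cancel because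
    -- the residual vanishes.
    have hd : Φ.P *ᵥ deriv z t = _ :=
      ((Matrix.hasDerivAt_mulVec Φ.P (hz.hasDerivAt_Ioi ht)).congr_of_eventuallyEq
        (Eventually.of_forall fun t => (hPz t).symm)).unique (hwd t ht)
    have h2 := Φ.P_mulVec_injected (z t)
    have h3 : Φ.Q *ᵥ (C *ᵥ z t) = Φ.Q *ᵥ y t := by
      rw [← hqz t ht, mulVecLin_apply, mulVec_mulVec]
    rw [hPz, h3, mulVec_add] at h2
    simp only [mulVec_sub, hd, mulVecLin_apply, hgdef, add_mulVec, sub_mulVec, ← mulVec_mulVec,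
      ← h2, hr' t ht]
    abel
  obtain ⟨z, hz, hqz, hzS⟩ := exists_steering Φ.decoupledA.mulVecLin (Φ.Q * C).mulVecLin
    (LinearMap.range Φ.hiddenB.mulVecLin) k hg
    (hstart.imp fun z h => ⟨h.1, h.2.1, fun t ht => hk (h.2.2 t ht)⟩)
  obtain ⟨I, -, hI⟩ := LinearMap.exists_inverse_on_map Φ.hiddenB.mulVecLin ⊤
  rw [Submodule.map_top] at hI
  set v : ℝ → U → ℝ := fun t => I (deriv z t - Φ.decoupledA.mulVecLin (z t) - g t) with hv
  have hvc : ContinuousOn v (Set.Ioi 0) :=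
    (I.contDiffOn_comp_real (N := (0 : ℕ)) ((hz.deriv_Ioi.sub
      (Φ.decoupledA.mulVecLin.contDiffOn_comp_real (hz.of_le (by simp)))).sub
      (hg.of_le (by simp)))).continuousOn
  have hDv : ∀ x : U → ℝ, D *ᵥ (x - pinv D *ᵥ (D *ᵥ x)) = 0 := fun x => by
    rw [mulVec_sub, mulVec_mulVec, mulVec_mulVec,
      (pinv_spec D).mul_mul_left, sub_self]
  -- The first term produces the `V` part of `y - C z`. The second lies in `ker D` and supplies the
  -- remaining defect through `hiddenB`.
  refine ⟨z, fun t => pinv (Φ.V * D) *ᵥ (Φ.V *ᵥ (y t - C *ᵥ z t)) + (v t - pinv D *ᵥ (D *ᵥ v t)),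
    ?_, fun t ht => ?_, fun t ht => ?_⟩
  · exact (Matrix.continuousOn_mulVec _ (Matrix.continuousOn_mulVec _ (hy.continuousOn.sub
      (Matrix.continuousOn_mulVec _ hz.continuousOn)))).add
      (hvc.sub (Matrix.continuousOn_mulVec _ (Matrix.continuousOn_mulVec _ hvc)))
  · refine (hz.hasDerivAt_Ioi (N := 0) ht).congr_deriv ?_
    have h1 : Φ.hiddenB *ᵥ v t = deriv z t - Φ.decoupledA *ᵥ z t - g t := hI _ (hzS t ht)
    have h2 : deriv z t = Φ.hiddenB *ᵥ v t + Φ.decoupledA *ᵥ z t + g t := by rw [h1]; abel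
    rw [h2]
    simp only [hiddenB, decoupledA, hgdef, BZ, mulVec_add, mulVec_sub, sub_mulVec,
      ← mulVec_mulVec, one_mulVec]
    abel
  · rw [mulVec_add, hDv, add_zero, ← sub_eq_zero, ← sub_sub]
    refine Φ.eq_zero_of_V_of_Q ?_ ?_
    · rw [mulVec_sub, Φ.VD_mulVec_pinv, sub_self]
    · have h3 : Φ.Q *ᵥ (C *ᵥ z t) = Φ.Q *ᵥ y t := by
        rw [← hqz t ht, mulVecLin_apply, mulVec_mulVec]
      rw [mulVec_sub, Φ.Q_mulVec_D, sub_zero, mulVec_sub, h3, sub_self]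

end IdentificationFilter

/-! ### Kron reduction of the network -/

theorem Matrix.toRows₁_mulVec {m₁ m₂ k : Type*} [Fintype k] (M : Matrix (m₁ ⊕ m₂) k ℝ)
    (v : k → ℝ) : M.toRows₁ *ᵥ v = (M *ᵥ v) ∘ Sum.inl := rfl

theorem Matrix.toRows₂_mulVec {m₁ m₂ k : Type*} [Fintype k] (M : Matrix (m₁ ⊕ m₂) k ℝ)
    (v : k → ℝ) : M.toRows₂ *ᵥ v = (M *ᵥ v) ∘ Sum.inr := rfl

theorem Matrix.mulVec_eq_toCols {m k₁ k₂ : Type*} [Fintype k₁] [Fintype k₂]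
    (M : Matrix m (k₁ ⊕ k₂) ℝ) (v : k₁ ⊕ k₂ → ℝ) :
    M *ᵥ v = M.toCols₁ *ᵥ (v ∘ Sum.inl) + M.toCols₂ *ᵥ (v ∘ Sum.inr) := by
  rw [← fromCols_mulVec, fromCols_toCols]

namespace PowerNetwork

variable {n m p : ℕ} (N : PowerNetwork n m)

theorem networkWeight_nonneg (v w : Vertex n m) :
    0 ≤ networkWeight N.internalWeight N.lineWeight v w := by
  have hd : ∀ i j, 0 ≤ diagonal N.internalWeight i j := fun i j => by
    rw [diagonal_apply]
    split_ifs
    exacts [(N.internalWeight_pos i).le, le_rfl]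
  rcases v with i | i | i <;> rcases w with j | j | j <;>
    simp [networkWeight, hd, N.lineWeight_nonneg]

theorem networkWeight_comm (v w : Vertex n m) :
    networkWeight N.internalWeight N.lineWeight v w
      = networkWeight N.internalWeight N.lineWeight w v := by
  have hs : (networkWeight N.internalWeight N.lineWeight).IsSymm := by
    rw [networkWeight, isSymm_fromBlocks_iff, transpose_fromRows, diagonal_transpose,
      transpose_fromCols, diagonal_transpose, transpose_zero, transpose_zero]
    exact ⟨isSymm_zero, rfl, rfl, N.lineWeight_symm⟩
  exact hs.apply w v

theorem laplacian_mulVec (f : Vertex n m → ℝ) (v : Vertex n m) :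
    (N.laplacian *ᵥ f) v
      = ∑ w, networkWeight N.internalWeight N.lineWeight v w * (f v - f w) := by
  rw [laplacian, sub_mulVec, Pi.sub_apply, mulVec_diagonal, Finset.sum_mul]
  simp only [mulVec, dotProduct, mul_sub, Finset.sum_sub_distrib]

/-- Symmetrising the double sum turns twice the energy into the sum of `W v w * (f v - f w) ^ 2`. If
it vanishes, `f` is constant along edges, hence along walks. -/
theorem eq_of_laplacian_dotProduct_eq_zero {f : Vertex n m → ℝ}
    (h : f ⬝ᵥ (N.laplacian *ᵥ f) = 0) (v w : Vertex n m) : f v = f w := by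
  set W := networkWeight N.internalWeight N.lineWeight with hW
  have h1 : ∑ v, ∑ w, W v w * (f v * (f v - f w)) = 0 := by
    rw [← h]
    refine Finset.sum_congr rfl fun v _ => ?_
    rw [laplacian_mulVec, Finset.mul_sum]
    exact Finset.sum_congr rfl fun w _ => by ring
  have h2 : ∑ v, ∑ w, W v w * (f w * (f w - f v)) = 0 := by
    rw [Finset.sum_comm, ← h1]
    exact Finset.sum_congr rfl fun v _ => Finset.sum_congr rfl fun w _ => by
      rw [hW, N.networkWeight_comm]
  have h3 : ∑ v, ∑ w, W v w * (f v - f w) ^ 2 = 0 := by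
    have h4 := congrArg₂ (· + ·) h1 h2
    simp only [← Finset.sum_add_distrib, add_zero] at h4
    rw [← h4]
    exact Finset.sum_congr rfl fun v _ => Finset.sum_congr rfl fun w _ => by ring
  have hnn : ∀ v w, 0 ≤ W v w * (f v - f w) ^ 2 := fun v w =>
    mul_nonneg (N.networkWeight_nonneg v w) (sq_nonneg _)
  have h5 : ∀ v w, W v w ≠ 0 → f v = f w := fun v w hvw => by
    have h6 := (Finset.sum_eq_zero_iff_of_nonneg
      (fun v _ => Finset.sum_nonneg fun w _ => hnn v w)).mp h3 v (Finset.mem_univ v)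
    have h7 := (Finset.sum_eq_zero_iff_of_nonneg (fun w _ => hnn v w)).mp h6 w (Finset.mem_univ w)
    exact sub_eq_zero.mp (pow_eq_zero_iff two_ne_zero |>.mp
      ((mul_eq_zero.mp h7).resolve_left hvw))
  obtain ⟨walk⟩ := N.connected.preconnected v w
  induction walk with
  | nil => rfl
  | cons hadj _ ih =>
    refine Eq.trans ?_ ih
    rw [SimpleGraph.fromRel_adj] at hadj
    rcases hadj.2 with h | h
    exacts [h5 _ _ h, (h5 _ _ h).symm]

/-- A kernel vector extended by zero to the generators has zero energy, so it is constant and equals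
its value `0` at a generator, which exists as `0 < n`. -/
theorem isUnit_det_Lll (hn : 0 < n) : IsUnit N.Lll.det := by
  rw [← isUnit_iff_isUnit_det, ← mulVec_injective_iff_isUnit]
  refine (injective_iff_map_eq_zero N.Lll.mulVecLin).mpr fun θ hθ => ?_
  have hθ : N.Lll *ᵥ θ = 0 := hθ
  set f : Vertex n m → ℝ := Sum.elim 0 θ with hf
  have h1 : f ⬝ᵥ (N.laplacian *ᵥ f) = 0 := by
    have h2 : (N.laplacian *ᵥ f) ∘ Sum.inr = N.Lll *ᵥ θ := by
      rw [← fromBlocks_toBlocks N.laplacian, fromBlocks_mulVec, hf]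
      simp [Lll]
    rw [hf, ← Sum.elim_comp_inl_inr (N.laplacian *ᵥ Sum.elim 0 θ), ← hf, h2, hθ,
      sumElim_dotProduct_sumElim, zero_dotProduct, dotProduct_zero, add_zero]
  funext b
  exact N.eq_of_laplacian_dotProduct_eq_zero h1 (Sum.inr b) (Sum.inl ⟨0, hn⟩)

theorem E_mulVec_inl (x : StateIdx n m → ℝ) (j : Fin n ⊕ Fin n) :
    (N.E *ᵥ x) (Sum.inl j) = Sum.elim (fun _ => 1) N.inertia j * x (Sum.inl j) := by
  rcases j with i | i <;> simp [E, fromBlocks_mulVec, mulVec_diagonal]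

theorem E_mulVec_inr (x : StateIdx n m → ℝ) (b : Bus n m) : (N.E *ᵥ x) (Sum.inr b) = 0 := by
  simp [E, fromBlocks_mulVec]

theorem inertia_mul_inv_mulVec (v : Fin n → ℝ) (i : Fin n) :
    N.inertia i * ((diagonal N.inertia)⁻¹ *ᵥ v) i = v i := by
  have h : IsUnit (diagonal N.inertia).det := by
    rw [det_diagonal]
    exact (Finset.prod_pos fun i _ => N.inertia_pos i).ne'.isUnit
  rw [← mulVec_diagonal, mulVec_mulVec, mul_nonsing_inv _ h, one_mulVec]

theorem attackB_mulVec (u : AttackIdx n m p → ℝ) : attackB n m p *ᵥ u = u ∘ Sum.inl := by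
  simp [attackB, fromCols_mulVec]

theorem A_mulVec_inr (x : StateIdx n m → ℝ) :
    (N.A *ᵥ x) ∘ Sum.inr
      = -(N.Llg *ᵥ (x ∘ Sum.inl ∘ Sum.inl) + N.Lll *ᵥ (x ∘ Sum.inr)) := by
  funext b
  simp [A, neg_mulVec, fromBlocks_mulVec, fromCols_mulVec, Function.comp_assoc]

theorem bus_equation_iff (hn : 0 < n) (x : StateIdx n m → ℝ) (u : AttackIdx n m p → ℝ) :
    (∀ b, (N.A *ᵥ x + attackB n m p *ᵥ u) (Sum.inr b) = 0) ↔
      x ∘ Sum.inr = N.Lll⁻¹ *ᵥ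
        (u ∘ Sum.inl ∘ Sum.inr - N.Llg *ᵥ (x ∘ Sum.inl ∘ Sum.inl)) := by
  have hu := N.isUnit_det_Lll hn
  have h1 : (∀ b, (N.A *ᵥ x + attackB n m p *ᵥ u) (Sum.inr b) = 0) ↔
      N.Lll *ᵥ (x ∘ Sum.inr) = u ∘ Sum.inl ∘ Sum.inr - N.Llg *ᵥ (x ∘ Sum.inl ∘ Sum.inl) := by
    rw [funext_iff]
    refine forall_congr' fun b => ?_
    have h2 := congrFun (N.A_mulVec_inr x) b
    simp only [Function.comp_apply, Pi.neg_apply, Pi.add_apply] at h2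
    simp only [Pi.add_apply, Pi.sub_apply, h2, attackB_mulVec, Function.comp_apply]
    constructor <;> intro h <;> linarith
  rw [h1]
  constructor
  · intro h
    rw [← h, mulVec_mulVec, nonsing_inv_mul _ hu, one_mulVec]
  · intro h
    rw [h, mulVec_mulVec, mul_nonsing_inv _ hu, one_mulVec]

theorem generator_equation (hn : 0 < n) {x : StateIdx n m → ℝ} {u : AttackIdx n m p → ℝ}
    (h : ∀ b, (N.A *ᵥ x + attackB n m p *ᵥ u) (Sum.inr b) = 0) (j : Fin n ⊕ Fin n) :
    (N.A *ᵥ x + attackB n m p *ᵥ u) (Sum.inl j) = Sum.elim (fun _ => 1) N.inertia j *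
      (N.kronA *ᵥ (x ∘ Sum.inl) + N.kronB p *ᵥ u) j := by
  rw [N.bus_equation_iff hn] at h
  rcases j with i | i
  · simp [A, kronA, kronB, neg_mulVec, fromBlocks_mulVec, fromRows_mulVec, fromCols_mulVec,
      attackB_mulVec, toRows₁_mulVec]
  · have hA : (N.A *ᵥ x) (Sum.inl (Sum.inr i)) = -((N.Lgg *ᵥ (x ∘ Sum.inl ∘ Sum.inl)) i
        + (diagonal N.damping *ᵥ (x ∘ Sum.inl ∘ Sum.inr)) i + (N.Lgl *ᵥ (x ∘ Sum.inr)) i) := by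
      simp [A, neg_mulVec, fromBlocks_mulVec, fromRows_mulVec, Function.comp_assoc]
    have hKA : N.inertia i * (N.kronA *ᵥ (x ∘ Sum.inl)) (Sum.inr i)
        = -(((N.Lgg - N.Lgl * N.Lll⁻¹ * N.Llg) *ᵥ (x ∘ Sum.inl ∘ Sum.inl)) i
          + (diagonal N.damping *ᵥ (x ∘ Sum.inl ∘ Sum.inr)) i) := by
      rw [kronA, fromBlocks_mulVec, Sum.elim_inr, Pi.add_apply, neg_mulVec, neg_mulVec,
        ← mulVec_mulVec, ← mulVec_mulVec, Pi.neg_apply, Pi.neg_apply, mul_add, mul_neg, mul_neg,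
        inertia_mul_inv_mulVec, inertia_mul_inv_mulVec, Function.comp_assoc, Function.comp_assoc]
      ring
    have hKB : N.inertia i * (N.kronB p *ᵥ u) (Sum.inr i) = u (Sum.inl (Sum.inl (Sum.inr i)))
        - (N.Lgl *ᵥ (N.Lll⁻¹ *ᵥ (u ∘ Sum.inl ∘ Sum.inr))) i := by
      rw [kronB, fromRows_mulVec, Sum.elim_inr, fromCols_mulVec, zero_mulVec, add_zero,
        sub_mulVec, Pi.sub_apply, mul_sub]
      simp only [← mulVec_mulVec, Matrix.mul_assoc, inertia_mul_inv_mulVec, toRows₁_mulVec,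
        toRows₂_mulVec, one_mulVec, Function.comp_apply, Function.comp_assoc]
    rw [Pi.add_apply, Pi.add_apply, hA, Sum.elim_inr, mul_add, hKA, hKB, h, attackB_mulVec]
    simp only [mulVec_sub, sub_mulVec, ← mulVec_mulVec, Pi.sub_apply, Function.comp_apply]
    ring

theorem output_equation (hn : 0 < n) (C : Matrix (Fin p) (StateIdx n m) ℝ)
    {x : StateIdx n m → ℝ} {u : AttackIdx n m p → ℝ}
    (h : ∀ b, (N.A *ᵥ x + attackB n m p *ᵥ u) (Sum.inr b) = 0) :
    C *ᵥ x + attackD n m p *ᵥ u = N.kronC C *ᵥ (x ∘ Sum.inl) + N.kronD C *ᵥ u := by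
  rw [N.bus_equation_iff hn] at h
  rw [mulVec_eq_toCols C, h, mulVec_eq_toCols C.toCols₁, kronC, kronD, attackD]
  simp only [fromCols_mulVec, toRows₂_mulVec, one_mulVec, zero_mulVec, zero_add, sub_mulVec,
    mulVec_sub, ← mulVec_mulVec, Function.comp_assoc]
  abel

/-- The generator state of a trajectory satisfies the Kron-reduced equations. -/
theorem IsTrajectory.kron (hn : 0 < n) {N : PowerNetwork n m} {u : ℝ → AttackIdx n m p → ℝ}
    {x : ℝ → StateIdx n m → ℝ} (hx : N.IsTrajectory u x) :
    ContinuousOn (fun t i => x t (Sum.inl i)) (Set.Ici 0) ∧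
    (∀ t > 0, ContinuousAt u t → HasDerivAt (fun t i => x t (Sum.inl i))
      (N.kronA *ᵥ (fun i => x t (Sum.inl i)) + N.kronB p *ᵥ u t) t) ∧
    ∀ (C : Matrix (Fin p) (StateIdx n m) ℝ), ∀ t ≥ 0, C *ᵥ x t + attackD n m p *ᵥ u t
      = N.kronC C *ᵥ (fun i => x t (Sum.inl i)) + N.kronD C *ᵥ u t := by
  obtain ⟨h1, h2, h3⟩ := hx
  have hpos : ∀ j : Fin n ⊕ Fin n, Sum.elim (fun _ => 1) N.inertia j ≠ 0 := by
    rintro (i | i)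
    exacts [one_ne_zero, (N.inertia_pos i).ne']
  have hE : ∀ t j, x t (Sum.inl j)
      = (Sum.elim (fun _ => 1) N.inertia j)⁻¹ * (N.E *ᵥ x t) (Sum.inl j) := fun t j => by
    rw [E_mulVec_inl, inv_mul_cancel_left₀ (hpos j)]
  refine ⟨?_, fun t ht hu => ?_, fun C t ht => N.output_equation hn C (h3 t ht)⟩
  · refine continuousOn_pi.mpr fun j => ?_
    simp only [hE _ j]
    exact continuousOn_const.mul (continuousOn_pi.mp h1 (Sum.inl j))
  · refine hasDerivAt_pi.mpr fun j => ?_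
    simp only [hE _ j]
    refine ((hasDerivAt_pi.mp (h2 t ht hu) (Sum.inl j)).const_mul
      ((Sum.elim (fun _ => 1) N.inertia j)⁻¹)).congr_deriv ?_
    rw [N.generator_equation hn (h3 t ht.le), inv_mul_cancel_left₀ (hpos j)]
    rfl

/-- A solution of the Kron-reduced equations extends to a trajectory with the same output. -/
theorem exists_isTrajectory_of_kron (hn : 0 < n) (C : Matrix (Fin p) (StateIdx n m) ℝ)
    {u : ℝ → AttackIdx n m p → ℝ} {z : ℝ → Fin n ⊕ Fin n → ℝ}
    (hz : ∀ t ≥ 0, HasDerivAt z (N.kronA *ᵥ z t + N.kronB p *ᵥ u t) t) :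
    ∃ x, N.IsTrajectory u x ∧ ∀ t ≥ 0,
      C *ᵥ x t + attackD n m p *ᵥ u t = N.kronC C *ᵥ z t + N.kronD C *ᵥ u t := by
  -- The bus angles are read off the bus equation. They need no regularity, since `E` annihilates
  -- them.
  set x : ℝ → StateIdx n m → ℝ := fun t => Sum.elim (z t)
    (N.Lll⁻¹ *ᵥ (u t ∘ Sum.inl ∘ Sum.inr - N.Llg *ᵥ (z t ∘ Sum.inl))) with hx
  have hb : ∀ t b, (N.A *ᵥ x t + attackB n m p *ᵥ u t) (Sum.inr b) = 0 := fun t =>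
    (N.bus_equation_iff hn _ _).mpr rfl
  have hd : ∀ t ≥ 0, HasDerivAt (fun s => N.E *ᵥ x s) (N.A *ᵥ x t + attackB n m p *ᵥ u t) t := by
    intro t ht
    refine hasDerivAt_pi.mpr ?_
    rintro (j | b)
    · simp only [E_mulVec_inl]
      rw [N.generator_equation hn (hb t)]
      exact (hasDerivAt_pi.mp (hz t ht) j).const_mul _
    · simp only [E_mulVec_inr, hb]
      exact hasDerivAt_const t 0
  exact ⟨x, ⟨fun t ht => (hd t ht).continuousAt.continuousWithinAt, fun t ht _ => hd t ht.le,
    fun t _ => hb t⟩, fun t _ => N.output_equation hn C (hb t)⟩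

end PowerNetwork

/-! ### Attack modes -/

theorem colsOf_mulVec {r ι : Type*} [Fintype ι] (B : Matrix r ι ℝ) (K : Finset ι) {v : ι → ℝ}
    (hv : ∀ i ∉ K, v i = 0) : colsOf B K *ᵥ (fun i => v i.1) = B *ᵥ v := by
  funext j
  simp only [colsOf, mulVec, dotProduct, submatrix_apply, id_eq]
  rw [Finset.sum_coe_sort K (fun i => B j i * v i)]
  exact Finset.sum_subset (Finset.subset_univ K) fun i _ hi => by rw [hv i hi, mul_zero]

theorem IsPiecewiseContinuous.countable_discontinuities {V : Type*} [TopologicalSpace V]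
    {f : ℝ → V} (hf : IsPiecewiseContinuous f) : {t | 0 < t ∧ ¬ ContinuousAt f t}.Countable := by
  refine (Set.countable_iUnion fun k : ℕ => (hf.1 k).countable).mono fun t ht => ?_
  obtain ⟨k, hk⟩ := exists_nat_gt t
  exact Set.mem_iUnion.mpr ⟨k, ⟨ht.1, hk⟩, ht.2⟩

theorem IsAttackMode.exists_ne_zero {ι : Type*} {K : Finset ι} {u : ℝ → ι → ℝ}
    (hu : IsAttackMode K u) {s : Set ℝ} (hs : s.Countable) {i : ι} (hi : i ∈ K) :
    ∃ t > 0, t ∉ s ∧ u t i ≠ 0 := by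
  by_contra! h
  refine hu.2.2 i hi ?_
  have h1 : ∀ᵐ t ∂(MeasureTheory.volume : MeasureTheory.Measure ℝ), t ∉ insert 0 s :=
    (hs.insert 0).ae_notMem _
  filter_upwards [MeasureTheory.ae_restrict_of_ae h1,
    MeasureTheory.ae_restrict_mem measurableSet_Ici] with t ht ht0
  rw [Set.mem_insert_iff, not_or] at ht
  exact h t (lt_of_le_of_ne ht0 (Ne.symm ht.1)) ht.2

/-- A nonzero value of a continuous entry persists on some `[t, b)`, an interval of positive measure
inside `[0, ∞)`. -/
theorem isAttackMode_of_continuousAt {ι : Type*} {K : Finset ι} {u : ℝ → ι → ℝ}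
    (hc : ∀ t ≥ 0, ContinuousAt u t) (h0 : ∀ i ∉ K, ∀ t ≥ 0, u t i = 0)
    (h1 : ∀ i ∈ K, ∃ t ≥ 0, u t i ≠ 0) : IsAttackMode K u := by
  refine ⟨⟨fun T => ?_, fun t ht => ⟨u t, (hc t ht.le).tendsto.mono_left nhdsWithin_le_nhds⟩,
    fun t ht => ⟨u t, (hc t ht).tendsto.mono_left nhdsWithin_le_nhds⟩⟩, h0, fun i hi hae => ?_⟩
  · refine Set.Finite.subset Set.finite_empty fun t ht => ht.2 (hc t ht.1.1.le)
  · obtain ⟨t, ht, hne⟩ := h1 i hi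
    have hci : ContinuousAt (fun t => u t i) t := (continuous_apply i).continuousAt.comp (hc t ht)
    obtain ⟨b, hb, hsub⟩ := mem_nhdsGE_iff_exists_Ico_subset.mp
      (nhdsWithin_le_nhds (s := Set.Ici t) (hci.eventually_ne hne))
    rw [MeasureTheory.ae_restrict_iff' measurableSet_Ici] at hae
    have hzero : MeasureTheory.volume (Set.Ico t b) = 0 := by
      refine MeasureTheory.measure_mono_null (fun r hr => ?_) (MeasureTheory.ae_iff.mp hae)
      exact fun hr0 => hsub hr (hr0 (ht.le.trans hr.1))
    rw [Real.volume_Ico, ENNReal.ofReal_eq_zero] at hzero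
    have : t < b := hb
    linarith

theorem continuousAt_comp_add_const {V : Type*} [TopologicalSpace V] {f : ℝ → V}
    {t c : ℝ} (h : ContinuousAt f (t + c)) : ContinuousAt (fun t => f (t + c)) t :=
  ContinuousAt.comp (f := fun t : ℝ => t + c) h (continuous_add_const c).continuousAt

/-! ### The identification theorem -/

/-- If the filter of `K` has zero residual, the true attack can be replaced by a smooth one whose
measurements are also generated by inputs in `K`. -/
theorem IdentificationFilter.exists_smooth_confusion {X ι : Type*} [Fintype X] [DecidableEq X]
    [Fintype ι] [DecidableEq ι] {p : ℕ} {A : Matrix X X ℝ} {B : Matrix X ι ℝ}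
    {C : Matrix (Fin p) X ℝ} {D : Matrix (Fin p) ι ℝ} {K L : Finset ι}
    (Φ : IdentificationFilter A (colsOf B K) C (colsOf D K))
    {u : ℝ → ι → ℝ} (hu : IsAttackMode L u) {z : ℝ → X → ℝ} (hz : ContinuousOn z (Set.Ici 0))
    (hzd : ∀ t > 0, ContinuousAt u t → HasDerivAt z (A *ᵥ z t + B *ᵥ u t) t)
    {y : ℝ → Fin p → ℝ} (hy : ∀ t ≥ 0, y t = C *ᵥ z t + D *ᵥ u t)
    {w : ℝ → Fin Φ.s → ℝ} (hwc : ContinuousOn w (Set.Ici 0))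
    (hwd : ∀ t > 0, ContinuousAt u t → HasDerivAt w ((Φ.AK + Φ.G * Φ.M) *ᵥ w t
      + (Φ.P * Φ.BZ * Φ.V - (Φ.P * Φ.J + Φ.G * Φ.H) * Φ.Q) *ᵥ y t) t)
    (hr : ∀ t ≥ 0, Φ.residual y w t = 0) :
    ∃ (uL uK : ℝ → ι → ℝ) (zL zK : ℝ → X → ℝ),
      (∀ t ≥ 0, ContinuousAt uL t) ∧ (∀ t ≥ 0, ContinuousAt uK t) ∧
      (∀ i ∉ L, ∀ t ≥ 0, uL t i = 0) ∧ (∀ i ∈ L, ∃ t ≥ 0, uL t i ≠ 0) ∧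
      (∀ i ∉ K, ∀ t ≥ 0, uK t i = 0) ∧
      (∀ t ≥ 0, HasDerivAt zL (A *ᵥ zL t + B *ᵥ uL t) t) ∧
      (∀ t ≥ 0, HasDerivAt zK (A *ᵥ zK t + B *ᵥ uK t) t) ∧
      ∀ t ≥ 0, C *ᵥ zL t + D *ᵥ uL t = C *ᵥ zK t + D *ᵥ uK t := by
  obtain ⟨N, hN⟩ := Φ.exists_input_of_residual_eq_zero
  set s : Set ℝ := {t | 0 < t ∧ ¬ ContinuousAt u t} with hs
  have hsc : s.Countable := hu.1.countable_discontinuities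
  have huc : ∀ t > 0, t ∉ s → ContinuousAt u t := fun t ht hts => by
    by_contra h
    exact hts ⟨ht, h⟩
  have hza : ∀ t > 0, ContinuousAt z t := fun t ht => hz.continuousAt (Ici_mem_nhds ht)
  have hwa : ∀ t > 0, ContinuousAt w t := fun t ht => hwc.continuousAt (Ici_mem_nhds ht)
  -- Plant state, filter state and attack are averaged together, so that the averaged measurements
  -- still drive the averaged filter with zero residual.
  let W := (X → ℝ) × (Fin Φ.s → ℝ) × (ι → ℝ)
  let πz : W →ₗ[ℝ] (X → ℝ) := LinearMap.fst ℝ _ _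
  let πw : W →ₗ[ℝ] (Fin Φ.s → ℝ) := LinearMap.fst ℝ _ _ ∘ₗ LinearMap.snd ℝ _ _
  let πu : W →ₗ[ℝ] (ι → ℝ) := LinearMap.snd ℝ _ _ ∘ₗ LinearMap.snd ℝ _ _
  let πi : ι → W →ₗ[ℝ] ℝ := fun i => LinearMap.proj i ∘ₗ πu
  let πy : W →ₗ[ℝ] (Fin p → ℝ) := C.mulVecLin ∘ₗ πz + D.mulVecLin ∘ₗ πu
  let T₁ : W →ₗ[ℝ] (X → ℝ) × (Fin Φ.s → ℝ) := πz.prod πw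
  let T₂ : W →ₗ[ℝ] (X → ℝ) × (Fin Φ.s → ℝ) :=
    (A.mulVecLin ∘ₗ πz + B.mulVecLin ∘ₗ πu).prod ((Φ.AK + Φ.G * Φ.M).mulVecLin ∘ₗ πw
      + (Φ.P * Φ.BZ * Φ.V - (Φ.P * Φ.J + Φ.G * Φ.H) * Φ.Q).mulVecLin ∘ₗ πy)
  let res : W →ₗ[ℝ] (Fin Φ.h → ℝ) := Φ.M.mulVecLin ∘ₗ πw - (Φ.H * Φ.Q).mulVecLin ∘ₗ πy
  let σ : ℝ → W := fun t => (z t, w t, u t)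
  obtain ⟨τ, hτ, hτd, hτR, hτne⟩ := exists_contDiffOn_solution
    (LinearMap.toContinuousLinearMap T₁) (LinearMap.toContinuousLinearMap T₂) (σ := σ) hsc
    (fun t ht hts => (hza t ht).prodMk ((hwa t ht).prodMk (huc t ht hts)))
    (fun a b => intervalIntegrable_of_oneSidedLimits hsc
      (fun t ht hts => (hza t ht).prodMk ((hwa t ht).prodMk (huc t ht hts)))
      (fun t ht => by
        obtain ⟨l, hl⟩ := hu.1.2.1 t ht
        exact ⟨_, ((hza t ht).tendsto.mono_left nhdsWithin_le_nhds).prodMk_nhds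
          (((hwa t ht).tendsto.mono_left nhdsWithin_le_nhds).prodMk_nhds hl)⟩)
      (fun t ht => by
        obtain ⟨l, hl⟩ := hu.1.2.2 t ht.le
        exact ⟨_, ((hza t ht).tendsto.mono_left nhdsWithin_le_nhds).prodMk_nhds
          (((hwa t ht).tendsto.mono_left nhdsWithin_le_nhds).prodMk_nhds hl)⟩))
    (fun t ht => ((hza t ht).prodMk (hwa t ht)).continuousWithinAt)
    (fun t ht hts => by
      have h1 := (hzd t ht (huc t ht hts)).prodMk (hwd t ht (huc t ht hts))
      rw [hy t ht.le] at h1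
      exact h1)
    L (fun i => LinearMap.toContinuousLinearMap (πi i))
    (fun i hi => hu.exists_ne_zero hsc hi) N
  have hres : ∀ t > 0, res (τ t) = 0 := fun t ht => by
    funext i
    refine hτR (LinearMap.toContinuousLinearMap (LinearMap.proj i ∘ₗ res)) (fun t ht => ?_) t ht
    have h1 := congrFun (hr t ht.le) i
    rw [residual, hy t ht.le] at h1
    exact h1
  have hout : ∀ i ∉ L, ∀ t > 0, πu (τ t) i = 0 := fun i hi =>
    hτR (LinearMap.toContinuousLinearMap (πi i))
      (fun t ht => hu.2.1 i hi t ht.le)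
  obtain ⟨zK, uK, huKc, hzKd, hyK⟩ := hN (fun t => πy (τ t)) (fun t => πw (τ t))
    (πy.contDiffOn_comp_real hτ) (πw.contDiffOn_comp_real hτ)
    (fun t ht => (hτd t ht).snd) hres
  have hzL : ∀ t > 0, HasDerivAt (fun t => πz (τ t)) (A *ᵥ πz (τ t) + B *ᵥ πu (τ t)) t :=
    fun t ht => (hτd t ht).fst
  have huL : ContinuousOn (fun t => πu (τ t)) (Set.Ioi 0) :=
    (πu.contDiffOn_comp_real hτ).continuousOn
  choose! c hc hcne using hτne
  -- The smooth solutions live on `t > 0`; shifting by `d` places them on `t ≥ 0`. Taking `d` below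
  -- every `c i` retains the witnesses of nonzero entries.
  obtain ⟨d, hdc, hd⟩ := (((Filter.eventually_all_finset L).mpr fun i hi =>
    (eventually_le_nhds (hc i hi)).filter_mono nhdsWithin_le_nhds :
      ∀ᶠ d in 𝓝[>] (0 : ℝ), ∀ i ∈ L, d ≤ c i).and self_mem_nhdsWithin).exists
  have hd : 0 < d := hd
  let vK : ℝ → ι → ℝ := fun t i => if h : i ∈ K then uK t ⟨i, h⟩ else 0
  have hvK : ∀ t, (fun i : {i // i ∈ K} => vK t i.1) = uK t := fun t => by
    funext i
    simp [vK, i.2]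
  have hvK0 : ∀ t, ∀ i ∉ K, vK t i = 0 := fun t i hi => by simp [vK, hi]
  have hvKc : ContinuousOn vK (Set.Ioi 0) := by
    refine continuousOn_pi.mpr fun i => ?_
    by_cases hi : i ∈ K
    · simpa [vK, hi] using continuousOn_pi.mp huKc ⟨i, hi⟩
    · simpa [vK, hi] using continuousOn_const
  have hB : ∀ t, colsOf B K *ᵥ uK t = B *ᵥ vK t := fun t => by
    rw [← hvK, colsOf_mulVec B K (hvK0 t)]
  have hD : ∀ t, colsOf D K *ᵥ uK t = D *ᵥ vK t := fun t => by
    rw [← hvK, colsOf_mulVec D K (hvK0 t)]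
  refine ⟨fun t => πu (τ (t + d)), fun t => vK (t + d), fun t => πz (τ (t + d)),
    fun t => zK (t + d), fun t ht => ?_, fun t ht => ?_, fun i hi t ht => ?_, fun i hi => ?_,
    fun i hi t ht => hvK0 _ i hi, fun t ht => ?_, fun t ht => ?_, fun t ht => ?_⟩
  · exact continuousAt_comp_add_const (f := fun t => πu (τ t))
      (huL.continuousAt (Ioi_mem_nhds (by linarith)))
  · exact continuousAt_comp_add_const
      (hvKc.continuousAt (Ioi_mem_nhds (by linarith)))
  · exact hout i hi _ (by linarith)
  · refine ⟨c i - d, sub_nonneg.mpr (hdc i hi), ?_⟩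
    show πu (τ (c i - d + d)) i ≠ 0
    rw [sub_add_cancel]
    exact hcne i hi
  · exact (hzL (t + d) (by linarith)).comp_add_const t d
  · have h1 := (hzKd (t + d) (by linarith)).comp_add_const t d
    rwa [hB] at h1
  · have h1 := hyK (t + d) (by linarith)
    rw [hD] at h1
    exact h1

theorem mainTheorem2 {n m p : ℕ} (hn : 0 < n) (N : PowerNetwork n m)
    (C : Matrix (Fin p) (StateIdx n m) ℝ)
    (K Kstar : Finset (AttackIdx n m p))
    (hident : N.IsIdentifiable C Kstar)
    (hcard : K.card ≤ Kstar.card)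
    (u : ℝ → AttackIdx n m p → ℝ) (hu : IsAttackMode Kstar u)
    (x : ℝ → StateIdx n m → ℝ) (hx : N.IsTrajectory u x)
    (y : ℝ → Fin p → ℝ) (hy : ∀ t, y t = C *ᵥ x t + attackD n m p *ᵥ u t)
    (Φ : IdentificationFilter N.kronA (colsOf (N.kronB p) K) (N.kronC C) (colsOf (N.kronD C) K))
    (w : ℝ → Fin Φ.s → ℝ)
    (hw : Φ.IsResponse (fun i => x 0 (Sum.inl i)) y w) :
    (∀ t ≥ 0, Φ.residual y w t = 0) ↔ K = Kstar := by
  classical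
  obtain ⟨hz, hzd, hout⟩ := hx.kron hn
  set z : ℝ → Fin n ⊕ Fin n → ℝ := fun t i => x t (Sum.inl i) with hzdef
  have hyz : ∀ t ≥ 0, y t = N.kronC C *ᵥ z t + N.kronD C *ᵥ u t := fun t ht => by
    rw [hy, hout C t ht]
  have hyc : ∀ t > 0, ContinuousAt u t → ContinuousAt y t := fun t ht hut => by
    have h1 : ContinuousAt (fun t => N.kronC C *ᵥ z t + N.kronD C *ᵥ u t) t :=
      (((N.kronC C).mulVecLin.continuous_of_finiteDimensional.continuousAt).comp
        (hz.continuousAt (Ici_mem_nhds ht))).add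
      (((N.kronD C).mulVecLin.continuous_of_finiteDimensional.continuousAt).comp hut)
    refine h1.congr ?_
    filter_upwards [Ici_mem_nhds ht] with r hr using (hyz r hr).symm
  constructor
  · intro hr
    by_contra hne
    obtain ⟨uL, uK, zL, zK, hcL, hcK, h0L, h1L, h0K, hdL, hdK, hyLK⟩ :=
      Φ.exists_smooth_confusion hu hz hzd hyz hw.2.1
        (fun t ht hut => hw.2.2 t ht (hyc t ht hut)) hr
    obtain ⟨xL, hxL, hoL⟩ := N.exists_isTrajectory_of_kron hn C hdL
    obtain ⟨xK, hxK, hoK⟩ := N.exists_isTrajectory_of_kron hn C hdK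
    -- Some entries of `uK` in `K` may vanish identically, so the competing attack set is the
    -- support of `uK`.
    refine hident ⟨K.filter fun i => ∃ t ≥ 0, uK t i ≠ 0,
      (Finset.card_filter_le _ _).trans hcard, fun hR => hne ?_, uL, uK, xL, xK,
      isAttackMode_of_continuousAt hcL h0L h1L, isAttackMode_of_continuousAt hcK ?_ ?_,
      hxL, hxK, fun t ht => ?_⟩
    -- If the support were `Kstar`, then `Kstar ⊆ K`, and the cardinality bound would force
    -- equality.
    · exact (Finset.eq_of_subset_of_card_le (hR ▸ Finset.filter_subset _ _) hcard).symm
    · intro i hi t ht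
      by_contra h
      exact hi (Finset.mem_filter.mpr ⟨by_contra fun hiK => h (h0K i hiK t ht), t, ht, h⟩)
    · exact fun i hi => (Finset.mem_filter.mp hi).2
    · rw [hoL t ht, hoK t ht, hyLK t ht]
  · rintro rfl
    have hcols : ∀ {r : Type} (F : Matrix r (AttackIdx n m p) ℝ), ∀ t ≥ 0,
        colsOf F K *ᵥ (fun i => u t i.1) = F *ᵥ u t := fun F t ht =>
      colsOf_mulVec F K fun i hi => hu.2.1 i hi t ht
    have huc : ∀ t > 0, t ∉ {t | 0 < t ∧ ¬ ContinuousAt u t} → ContinuousAt u t :=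
      fun t ht hts => by
        by_contra h
        exact hts ⟨ht, h⟩
    refine Φ.residual_eq_zero (u := fun t i => u t i.1) (z := z) hu.1.countable_discontinuities hz
      (fun t ht hts => ?_) (fun t ht => ?_) (fun t ht hts => hyc t ht (huc t ht hts)) hw
    · rw [hcols _ t ht.le]
      exact hzd t ht (huc t ht hts)
    · rw [hcols _ t ht]
      exact hyz t ht
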